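/- Let $\mathbb K=\mathbb R$ or $\mathbb C$. Let $(E_n)_{n\in\mathbb N}$ be a sequence of finite dimensional normed spaces over $\mathbb K$, infinitely many of which are nonzero, and let $(p_n)$ be a sequence of real numbers with $p_n>2$ for all $n$ and $p_n\to 2$. Assume: (a) for every $n$ and all $x,y\in E_n$, $\ \|x+y\|^2+\|x-y\|^2\ge 2\,(\|x\|^{p_n}+\|y\|^{p_n})^{2/p_n}$; (b) every $E_n$ has a basis $\mathcal B_n$ such that for every $y\in\mathcal B_n$ there is $x\in\mathcal B_n$ for which $(x,y)$ is an $\ell_{p_n}$-pair, i.e. $\|x+\lambda y\|^{p_n}=1+|\lambda|^{p_n}$ for all $\lambda\in\mathbb R$. Let $E=(\bigoplus_n E_n)_{\ell_2}$ with norm $\|x\|^2=\sum_n\|x(n)\|^2$, and let $\Theta(x)=\|x\|^2$. For a Hilbert space $H$ over $\mathbb K$, let $E\oplus_m H$ be $E\times H$ with the modular $\Theta(x)+\|h\|^2$ and the associated Luxemburg norm (so $\|(x,h)\|^2=\|x\|^2+\|h\|^2$). For an ultrafilter $\mathcal U$ on a set $I$, let $E_{\mathcal U}$ be the ultrapower,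 that is, $\ell_\infty(I,E)$ modulo the families tending to $0$ along $\mathcal U$, with modular $\Theta_{\mathcal U}([x_i]_{\mathcal U})=\lim_{i,\mathcal U}\Theta(x_i)$. Then: 1. $E$ is an infinite dimensional Banach space, and $\Theta$ is a convex modular on $E$ (nonnegative, convex, $\Theta(0)=0$, $\Theta(x)=0$ only for $x=0$, and $\Theta(cx)=\Theta(x)$ for $|c|=1$) whose Luxemburg norm $\inf\{r>0:\Theta(x/r)\le 1\}$ is the norm of $E$; and for some constant $C$, $\Theta(2x)\le C\,\Theta(x)$ for all $x$. 2. For every ultrafilter $\mathcal U$ there are a Hilbert space $H$ and a linear bijection $E_{\mathcal U}\to E\oplus_m H$ that preserves modulars. 3. For every Hilbert space $H$, every linear isometric operator $E\to E\oplus_m H$ has range exactly $E=E\times\{0\}$. 4. $E$ is uncountably categorical: there is an uncountable cardinal $\kappa$ such that, up to linear isometry, there is exactly one Banach space $Y$ of density character $\kappa$ that is elementarily equivalent to $E$, which means that for some ultrafilters $\mathcal U,\mathcal V$ the ultrapowers $E_{\mathcal U}$ and $Y_{\mathcal V}$ are linearly isometric. -/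

import Mathlib

open Filter Topology
open scoped ENNReal Cardinal

universe uK u v w

/-- The subspace of `ℓ_∞(I, X)` of the bounded families that tend to `0` along `𝒰`. -/
def nullFamilies (𝕜 : Type uK) [RCLike 𝕜] {I : Type v} (𝒰 : Ultrafilter I)
    (X : Type u) [NormedAddCommGroup X] [NormedSpace 𝕜 X] :
    Submodule 𝕜 (lp (fun _ : I => X) ∞) where
  carrier := {x | Tendsto (fun i => x i) (𝒰 : Filter I) (𝓝 0)}
  zero_mem' := by
    simp only [Set.mem_ofPred_eq, lp.coeFn_zero, Pi.zero_apply]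
    exact tendsto_const_nhds
  add_mem' := by
    intro a b ha hb
    simpa using Tendsto.add ha hb
  smul_mem' := by
    intro c a ha
    simpa using Tendsto.const_smul ha c

/-- The ultrapower `X_𝒰` of a normed space: the quotient of `ℓ_∞(I, X)` by the families that tend
to `0` along `𝒰`, with the quotient norm. -/
abbrev Ultrapower (𝕜 : Type uK) [RCLike 𝕜] {I : Type v} (𝒰 : Ultrafilter I)
    (X : Type u) [NormedAddCommGroup X] [NormedSpace 𝕜 X] : Type (max u v) :=
  lp (fun _ : I => X) ∞ ⧸ nullFamilies 𝕜 𝒰 X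

/-- `[x_i]_𝒰`, the class of a bounded family in the ultrapower. -/
noncomputable abbrev ultraMk (𝕜 : Type uK) [RCLike 𝕜] {I : Type v} (𝒰 : Ultrafilter I)
    {X : Type u} [NormedAddCommGroup X] [NormedSpace 𝕜 X] (x : lp (fun _ : I => X) ∞) :
    Ultrapower 𝕜 𝒰 X :=
  (nullFamilies 𝕜 𝒰 X).mkQ x

/-- `X` and `Y` are elementarily equivalent: for some ultrafilters `𝒰`, `𝒱`, on possibly different
index sets, the ultrapowers `X_𝒰` and `Y_𝒱` are linearly isometric. -/
def ElementarilyEquivalent (𝕜 : Type uK) [RCLike 𝕜]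
    (X : Type u) [NormedAddCommGroup X] [NormedSpace 𝕜 X]
    (Y : Type u) [NormedAddCommGroup Y] [NormedSpace 𝕜 Y] : Prop :=
  ∃ (I J : Type u) (𝒰 : Ultrafilter I) (𝒱 : Ultrafilter J),
    Nonempty (Ultrapower 𝕜 𝒰 X ≃ₗᵢ[𝕜] Ultrapower 𝕜 𝒱 Y)

/-- The density character: the least cardinality of a dense subset. -/
noncomputable def densityCharacter (X : Type u) [TopologicalSpace X] : Cardinal.{u} :=
  sInf {c | ∃ s : Set X, Dense s ∧ #s = c}

/-- `X` is `κ`-categorical: `X` is infinite dimensional, and up to linear isometry there is exactly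
one Banach space of density character `κ` in the elementary class of `X`. -/
def IsCategorical (𝕜 : Type uK) [RCLike 𝕜] (κ : Cardinal.{u})
    (X : Type u) [NormedAddCommGroup X] [NormedSpace 𝕜 X] : Prop :=
  ¬ FiniteDimensional 𝕜 X ∧
  (∃ (Y : Type u) (_ : NormedAddCommGroup Y) (_ : NormedSpace 𝕜 Y) (_ : CompleteSpace Y),
    ElementarilyEquivalent 𝕜 X Y ∧ densityCharacter Y = κ) ∧
  ∀ (Y : Type u) [NormedAddCommGroup Y] [NormedSpace 𝕜 Y] [CompleteSpace Y]
    (Z : Type u) [NormedAddCommGroup Z] [NormedSpace 𝕜 Z] [CompleteSpace Z],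
    ElementarilyEquivalent 𝕜 X Y → densityCharacter Y = κ →
    ElementarilyEquivalent 𝕜 X Z → densityCharacter Z = κ →
    Nonempty (Y ≃ₗᵢ[𝕜] Z)

/-- `X` is uncountably categorical: `κ`-categorical for some uncountable `κ`. -/
def IsUncountablyCategorical (𝕜 : Type uK) [RCLike 𝕜]
    (X : Type u) [NormedAddCommGroup X] [NormedSpace 𝕜 X] : Prop :=
  ∃ κ : Cardinal.{u}, ℵ₀ < κ ∧ IsCategorical 𝕜 κ X

/-- A (finite, faithful, symmetric) convex modular on a vector space. -/
structure IsConvexModular (𝕜 : Type uK) [RCLike 𝕜] {X : Type u} [AddCommGroup X] [Module 𝕜 X]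
    (Θ : X → ℝ) : Prop where
  nonneg : ∀ x, 0 ≤ Θ x
  map_zero : Θ 0 = 0
  faithful : ∀ x, Θ x = 0 → x = 0
  symmetric : ∀ (c : 𝕜) (x : X), ‖c‖ = 1 → Θ (c • x) = Θ x
  convex : ∀ (x y : X) (s t : ℝ), 0 ≤ s → 0 ≤ t → s + t = 1 →
    Θ ((s : 𝕜) • x + (t : 𝕜) • y) ≤ s * Θ x + t * Θ y

/-- The Luxemburg norm `inf {r > 0 : Θ (x / r) ≤ 1}` of a modular. -/
noncomputable def luxemburgNorm (𝕜 : Type uK) [RCLike 𝕜] {X : Type u} [AddCommGroup X]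
    [Module 𝕜 X] (Θ : X → ℝ) (x : X) : ℝ :=
  sInf {r : ℝ | 0 < r ∧ Θ (((r⁻¹ : ℝ) : 𝕜) • x) ≤ 1}

/-- The modular of the modular direct sum `X ⊕_m H` of a modular space with a Hilbert space, the
latter carrying its standard modular `‖h‖²`. The underlying vector space is `X × H`, and its norm
is the Luxemburg norm of this modular. -/
def sumHilbertModular {X : Type u} {H : Type v} [NormedAddCommGroup H] (Θ : X → ℝ) (z : X × H) :
    ℝ :=
  Θ z.1 + ‖z.2‖ ^ 2

/-- `Θ` is a convex modular on the Banach space `X` that induces its norm and satisfies a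
`Δ₂` condition. -/
structure IsDeltaTwoModularBanach (𝕜 : Type uK) [RCLike 𝕜]
    (X : Type u) [NormedAddCommGroup X] [NormedSpace 𝕜 X] (Θ : X → ℝ) : Prop where
  complete : CompleteSpace X
  modular : IsConvexModular 𝕜 Θ
  norm_eq : ∀ x, ‖x‖ = luxemburgNorm 𝕜 Θ x
  delta_two : ∃ C : ℝ, ∀ x, Θ ((2 : 𝕜) • x) ≤ C * Θ x

/-- Every ultrapower of `X` is linearly isomodular to `X ⊕_m H` for some Hilbert space `H`.
The ultrapower modular is `Θ_𝒰 ([x_i]_𝒰) = lim_𝒰 Θ (x_i)`, so that a linear bijection `T` from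
`X_𝒰` to `X ⊕_m H` preserves modulars when the modular of `T [x_i]_𝒰` is that limit. -/
def UltrapowersIsomodular (𝕜 : Type uK) [RCLike 𝕜]
    (X : Type u) [NormedAddCommGroup X] [NormedSpace 𝕜 X] (Θ : X → ℝ) : Prop :=
  ∀ (I : Type v) (𝒰 : Ultrafilter I),
    ∃ (H : Type (max u v)) (_ : NormedAddCommGroup H) (_ : InnerProductSpace 𝕜 H)
      (_ : CompleteSpace H) (T : Ultrapower 𝕜 𝒰 X ≃ₗ[𝕜] X × H),
      ∀ x : lp (fun _ : I => X) ∞,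
        Tendsto (fun i => Θ (x i)) (𝒰 : Filter I) (𝓝 (sumHilbertModular Θ (T (ultraMk 𝕜 𝒰 x))))

/-- For every Hilbert space `H`, every linear isometric operator `X → X ⊕_m H` maps `X` onto
`X`. -/
def EmbeddingsOnto (𝕜 : Type uK) [RCLike 𝕜]
    (X : Type u) [NormedAddCommGroup X] [NormedSpace 𝕜 X] (Θ : X → ℝ) : Prop :=
  ∀ (H : Type w) [NormedAddCommGroup H] [InnerProductSpace 𝕜 H] [CompleteSpace H]
    (T : X →ₗ[𝕜] X × H),
    (∀ x, luxemburgNorm 𝕜 (sumHilbertModular Θ) (T x) = ‖x‖) →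
    LinearMap.range T = LinearMap.range (LinearMap.inl 𝕜 X H)

/-- `(x, y)` is an `ℓ_p`-pair. -/
def IsEllPair (𝕜 : Type uK) [RCLike 𝕜] {X : Type u} [NormedAddCommGroup X] [NormedSpace 𝕜 X]
    (p : ℝ) (x y : X) : Prop :=
  ∀ t : ℝ, ‖x + (t : 𝕜) • y‖ ^ p = 1 + |t| ^ p

/-! ### Limits along ultrafilters. -/

section Ultralimit

variable {I : Type*} {𝒰 : Ultrafilter I}

/-! Everything rests on the class of Hilbert extensions of `E`, the spaces that are an `ℓ₂`-sum of a
copy of `E` and a space with the parallelogram law.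

The class is stable under ultrapowers (`HilbertExtension.ultrapower`). A bounded family in `E` has a
coordinatewise limit `e`, because the `E n` are finite dimensional, and in the limit the squared
norm splits into that of `e` and that of the remainder. Coordinates of the remainder tend to `0`, so
only large `n` matter; there `p n` is close to `2` and (a) is almost one half of the parallelogram
law. The other half follows by substituting sum and difference.

The copy of `E` is rigid (`range_eq_range_incl`). For an `ℓ_r`-pair `(u, v)` the second difference
of `‖·‖²` at `u` along `t v` is `O(t ^ r)`. A Hilbert component of `v` would contribute order `t ^
2`, and a component in `E m` with `p m < r` at least order `t ^ p m`, so neither occurs. By (b), an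
isometry from `E` therefore maps each finite dimensional sum of the `E m` with `p m ≥ r` into its
standard copy, and onto it by dimension.

If `Y` is elementarily equivalent to `E`, stability makes an ultrapower of `Y` a Hilbert extension,
and rigidity one ultrapower higher places its copy of `E` inside `Y`. Hence `Y` is a Hilbert
extension of the separable space `E`; at uncountable density it is determined by the Hilbert
dimension, which equals the density. -/

theorem Ultrafilter.exists_tendsto_of_norm_le {F : Type*} [NormedAddCommGroup F] [ProperSpace F]
    (𝒰 : Ultrafilter I) {f : I → F} {C : ℝ} (hf : ∀ i, ‖f i‖ ≤ C) :
    ∃ a, Tendsto f (𝒰 : Filter I) (𝓝 a) := by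
  obtain ⟨a, -, ha⟩ := (isCompact_closedBall (0 : F) C).ultrafilter_le_nhds (𝒰.map f)
    (le_principal_iff.2 (Filter.mem_map.2 (Filter.univ_mem' fun i => by simpa using hf i)))
  exact ⟨a, ha⟩

end Ultralimit

/-! ### Ultrapowers of normed spaces. -/

section Ultrapower

variable {𝕜 : Type uK} [RCLike 𝕜] {I : Type v} {𝒰 : Ultrafilter I}
  {X : Type u} [NormedAddCommGroup X] [NormedSpace 𝕜 X]

theorem mem_nullFamilies {x : lp (fun _ : I => X) ∞} :
    x ∈ nullFamilies 𝕜 𝒰 X ↔ Tendsto (fun i => x i) (𝒰 : Filter I) (𝓝 0) := Iff.rfl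

theorem lp.norm_apply_le (x : lp (fun _ : I => X) ∞) (i : I) : ‖x i‖ ≤ ‖x‖ :=
  lp.norm_apply_le_norm ENNReal.top_ne_zero x i

/-- The bounded family with the given terms. -/
def lp.ofBound {C : ℝ} (f : I → X) (hf : ∀ i, ‖f i‖ ≤ C) : lp (fun _ : I => X) ∞ :=
  ⟨f, memℓp_infty ⟨C, by rintro _ ⟨i, rfl⟩; exact hf i⟩⟩

@[simp] theorem lp.ofBound_apply {C : ℝ} (f : I → X) (hf : ∀ i, ‖f i‖ ≤ C) (i : I) :
    lp.ofBound f hf i = f i := rfl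

variable (𝕜 𝒰) in
theorem exists_tendsto_norm (x : lp (fun _ : I => X) ∞) :
    ∃ a, Tendsto (fun i => ‖x i‖) (𝒰 : Filter I) (𝓝 a) :=
  𝒰.exists_tendsto_of_norm_le fun i => by simpa using lp.norm_apply_le x i

/-- The norm of the ultrapower is the ultralimit of the norms. -/
theorem tendsto_norm_ultraMk (x : lp (fun _ : I => X) ∞) :
    Tendsto (fun i => ‖x i‖) (𝒰 : Filter I) (𝓝 ‖ultraMk 𝕜 𝒰 x‖) := by
  classical
  obtain ⟨a, ha⟩ := exists_tendsto_norm 𝒰 x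
  suffices h : ‖ultraMk 𝕜 𝒰 x‖ = a by rwa [h]
  apply le_antisymm
  · refine le_of_forall_pos_le_add fun ε hε => ?_
    have ha0 : 0 ≤ a := ge_of_tendsto' ha fun i => norm_nonneg _
    -- Replacing the terms of norm above `a + ε` by `0` does not change the class, and the sup norm
    -- of the result bounds the quotient norm.
    let z : lp (fun _ : I => X) ∞ := lp.ofBound (C := a + ε)
      (fun i => if ‖x i‖ ≤ a + ε then x i else 0) fun i => by
        split_ifs with h
        · exact h
        · simp; positivity
    have hz : ultraMk 𝕜 𝒰 x = ultraMk 𝕜 𝒰 z := by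
      refine (Submodule.Quotient.eq _).2 (mem_nullFamilies.2 ?_)
      refine tendsto_const_nhds.congr' ?_
      filter_upwards [ha.eventually_lt_const (lt_add_of_pos_right a hε)] with i hi
      simp [z, hi.le]
    rw [hz]
    refine (Submodule.Quotient.norm_mk_le _ z).trans ?_
    refine lp.norm_le_of_forall_le (by positivity) fun i => ?_
    simp only [z, lp.ofBound_apply]
    split_ifs with h
    · exact h
    · simp; positivity
  · refine le_of_forall_pos_le_add fun ε hε => ?_
    obtain ⟨m, hm, hm'⟩ := Submodule.Quotient.norm_mk_lt (S := nullFamilies 𝕜 𝒰 X)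
      (ultraMk 𝕜 𝒰 x) hε
    have h0 : Tendsto (fun i => x i - m i) (𝒰 : Filter I) (𝓝 0) :=
      mem_nullFamilies.1 ((Submodule.Quotient.eq _).1 hm.symm)
    have h1 : Tendsto (fun i => ‖x i‖ - ‖x i - m i‖) (𝒰 : Filter I) (𝓝 a) := by
      simpa using ha.sub h0.norm
    refine (le_of_tendsto' h1 fun i => ?_).trans hm'.le
    have := norm_sub_norm_le (x i) (x i - m i)
    rw [sub_sub_cancel] at this
    exact this.trans (lp.norm_apply_le m i)

theorem norm_ultraMk_eq {x : lp (fun _ : I => X) ∞} {a : ℝ}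
    (h : Tendsto (fun i => ‖x i‖) (𝒰 : Filter I) (𝓝 a)) : ‖ultraMk 𝕜 𝒰 x‖ = a :=
  tendsto_nhds_unique (tendsto_norm_ultraMk x) h

/-- Closedness turns the quotient seminorm of the ultrapower into a norm. -/
instance nullFamilies_isClosed :
    IsClosed (nullFamilies 𝕜 𝒰 X : Set (lp (fun _ : I => X) ∞)) := by
  refine isClosed_of_closure_subset fun x hx => ?_
  have h0 : ‖ultraMk 𝕜 𝒰 x‖ = 0 :=
    (QuotientAddGroup.norm_mk_eq_zero_iff_mem_closure
      (S := (nullFamilies 𝕜 𝒰 X).toAddSubgroup)).2 hx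
  have := tendsto_norm_ultraMk (𝕜 := 𝕜) (𝒰 := 𝒰) x
  rw [h0] at this
  exact mem_nullFamilies.2 (tendsto_zero_iff_norm_tendsto_zero.2 this)

theorem ultraMk_surjective (z : Ultrapower 𝕜 𝒰 X) : ∃ x, ultraMk 𝕜 𝒰 x = z :=
  Submodule.mkQ_surjective _ z

variable (𝕜 𝒰 X) in
/-- The diagonal embedding of a space into its ultrapower. -/
noncomputable def ultraDiag : X →ₗᵢ[𝕜] Ultrapower 𝕜 𝒰 X where
  toFun x := ultraMk 𝕜 𝒰 (lp.ofBound (fun _ => x) fun _ => le_rfl)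
  map_add' x y := by rw [← map_add]; rfl
  map_smul' c x := by rw [RingHom.id_apply, ← map_smul]; rfl
  norm_map' x := norm_ultraMk_eq tendsto_const_nhds

theorem ultraDiag_apply (x : X) :
    ultraDiag 𝕜 𝒰 X x = ultraMk 𝕜 𝒰 (lp.ofBound (fun _ => x) fun _ => le_rfl) := rfl

/-- The family of images of a bounded family under a linear isometry. -/
noncomputable def lp.mapIsometry {Y : Type w} [NormedAddCommGroup Y] [NormedSpace 𝕜 Y] (f : X →ₗᵢ[𝕜] Y) :
    lp (fun _ : I => X) ∞ →ₗ[𝕜] lp (fun _ : I => Y) ∞ where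
  toFun x := lp.ofBound (C := ‖x‖) (fun i => f (x i)) fun i => by
    simpa using lp.norm_apply_le x i
  map_add' x y := by ext i; simp
  map_smul' c x := by ext i; simp

/-- The ultrapower of a linear isometry. -/
noncomputable def ultraMap {Y : Type w} [NormedAddCommGroup Y] [NormedSpace 𝕜 Y]
    (𝒰 : Ultrafilter I) (f : X →ₗᵢ[𝕜] Y) : Ultrapower 𝕜 𝒰 X →ₗᵢ[𝕜] Ultrapower 𝕜 𝒰 Y where
  toLinearMap := Submodule.mapQ _ _ (lp.mapIsometry f) fun x hx => by
    have := (f.continuous.tendsto 0).comp (mem_nullFamilies.1 hx)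
    rw [map_zero] at this
    exact this
  norm_map' z := by
    obtain ⟨x, rfl⟩ := ultraMk_surjective z
    refine norm_ultraMk_eq (x := lp.mapIsometry f x) ?_
    simpa [lp.mapIsometry] using tendsto_norm_ultraMk (𝕜 := 𝕜) (𝒰 := 𝒰) x

theorem ultraMap_ultraMk {Y : Type w} [NormedAddCommGroup Y] [NormedSpace 𝕜 Y]
    (f : X →ₗᵢ[𝕜] Y) (x : lp (fun _ : I => X) ∞) :
    ultraMap 𝒰 f (ultraMk 𝕜 𝒰 x) = ultraMk 𝕜 𝒰 (lp.mapIsometry f x) := rfl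

end Ultrapower

/-! ### Finite truncations in `ℓ₂`-sums. -/

section EllTwo

variable {𝕜 : Type uK} [RCLike 𝕜] {E : ℕ → Type u} [∀ n, NormedAddCommGroup (E n)]
  [∀ n, NormedSpace 𝕜 (E n)]

theorem lp.hasSum_norm_sq (x : lp E 2) : HasSum (fun n => ‖x n‖ ^ 2) (‖x‖ ^ 2) := by
  simpa using lp.hasSum_norm (p := 2) (by simp) x

/-- The restriction of an element of the `ℓ₂`-sum to finitely many coordinates. -/
noncomputable def lp.truncate (S : Finset ℕ) (x : lp E 2) : lp E 2 :=
  ∑ n ∈ S, lp.single 2 n (x n)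

theorem lp.truncate_apply (S : Finset ℕ) (x : lp E 2) (n : ℕ) :
    lp.truncate S x n = if n ∈ S then x n else 0 := by
  classical
  rw [lp.truncate, lp.coeFn_sum, Finset.sum_apply]
  simp only [lp.coeFn_single]
  split_ifs with h
  · rw [Finset.sum_eq_single_of_mem n h (fun m _ hm => Pi.single_eq_of_ne hm.symm _)]
    simp
  · exact Finset.sum_eq_zero fun m hm => Pi.single_eq_of_ne (fun hh => h (by rwa [hh])) _

theorem lp.tendsto_truncate (x : lp E 2) :
    Tendsto (fun S : Finset ℕ => lp.truncate S x) atTop (𝓝 x) :=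
  lp.hasSum_single (by simp) x

theorem lp.norm_sq_truncate (S : Finset ℕ) (x : lp E 2) :
    ‖lp.truncate S x‖ ^ 2 = ∑ n ∈ S, ‖x n‖ ^ 2 := by
  refine (lp.hasSum_norm_sq (lp.truncate S x)).unique ?_
  rw [← Finset.sum_congr rfl fun n hn => by
    show ‖lp.truncate S x n‖ ^ 2 = ‖x n‖ ^ 2
    simp [lp.truncate_apply, hn]]
  exact hasSum_sum_of_ne_finset_zero fun n hn => by simp [lp.truncate_apply, hn]

theorem lp.norm_sq_sub_norm_sq_sub_truncate (S : Finset ℕ) (x e : lp E 2) :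
    ‖x‖ ^ 2 - ‖x - lp.truncate S e‖ ^ 2 = ∑ n ∈ S, (‖x n‖ ^ 2 - ‖x n - e n‖ ^ 2) := by
  refine ((lp.hasSum_norm_sq x).sub (lp.hasSum_norm_sq (x - lp.truncate S e))).unique ?_
  rw [← Finset.sum_congr rfl fun n hn => by
    show ‖x n‖ ^ 2 - ‖(x - lp.truncate S e) n‖ ^ 2 = ‖x n‖ ^ 2 - ‖x n - e n‖ ^ 2
    simp [lp.truncate_apply, hn]]
  exact hasSum_sum_of_ne_finset_zero fun n hn => by simp [lp.truncate_apply, hn]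

end EllTwo

/-! ### Hilbert extensions. -/

/-- `X` as the `ℓ₂`-sum of a copy of `F` and a space satisfying the parallelogram law. -/
structure HilbertExtension (𝕜 : Type uK) [RCLike 𝕜] (F : Type u) [NormedAddCommGroup F]
    [NormedSpace 𝕜 F] (X : Type v) [NormedAddCommGroup X] [NormedSpace 𝕜 X] where
  /-- The inclusion of the first summand. -/
  incl : F →ₗᵢ[𝕜] X
  /-- The projection onto the first summand. -/
  proj : X →ₗ[𝕜] F
  proj_incl : ∀ e, proj (incl e) = e
  norm_sq : ∀ x, ‖x‖ ^ 2 = ‖proj x‖ ^ 2 + ‖x - incl (proj x)‖ ^ 2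
  parallelogram : ∀ x y, proj x = 0 → proj y = 0 →
    ‖x + y‖ ^ 2 + ‖x - y‖ ^ 2 = 2 * (‖x‖ ^ 2 + ‖y‖ ^ 2)

namespace HilbertExtension

section Basic

variable {𝕜 : Type uK} [RCLike 𝕜] {F : Type u} [NormedAddCommGroup F] [NormedSpace 𝕜 F]
  {X : Type v} [NormedAddCommGroup X] [NormedSpace 𝕜 X] (A : HilbertExtension 𝕜 F X)

/-- The component of a vector in the Hilbert summand. -/
noncomputable def rest : X →ₗ[𝕜] X := LinearMap.id - A.incl.toLinearMap ∘ₗ A.proj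

theorem rest_apply (x : X) : A.rest x = x - A.incl (A.proj x) := rfl

@[simp] theorem proj_rest (x : X) : A.proj (A.rest x) = 0 := by
  rw [rest_apply, map_sub, A.proj_incl, sub_self]

theorem rest_of_proj_eq_zero {x : X} (h : A.proj x = 0) : A.rest x = x := by
  simp [rest_apply, h]

theorem incl_proj_add_rest (x : X) : A.incl (A.proj x) + A.rest x = x := by
  simp [rest_apply]

theorem norm_sq_eq (x : X) : ‖x‖ ^ 2 = ‖A.proj x‖ ^ 2 + ‖A.rest x‖ ^ 2 := A.norm_sq x

theorem rest_incl (e : F) : A.rest (A.incl e) = 0 := by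
  simp [rest_apply, A.proj_incl]

theorem norm_proj_le (x : X) : ‖A.proj x‖ ≤ ‖x‖ := by
  have := A.norm_sq_eq x
  exact le_of_sq_le_sq (by nlinarith [sq_nonneg ‖A.rest x‖]) (norm_nonneg _)

theorem parallelogram_rest (x y : X) : ‖A.rest (x + y)‖ ^ 2 + ‖A.rest (x - y)‖ ^ 2 =
    2 * (‖A.rest x‖ ^ 2 + ‖A.rest y‖ ^ 2) := by
  rw [map_add, map_sub]
  exact A.parallelogram _ _ (A.proj_rest x) (A.proj_rest y)

/-- A space is the extension of itself by the zero Hilbert space. -/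
def refl (𝕜 : Type uK) [RCLike 𝕜] (F : Type u) [NormedAddCommGroup F] [NormedSpace 𝕜 F] :
    HilbertExtension 𝕜 F F where
  incl := LinearIsometry.id
  proj := LinearMap.id
  proj_incl _ := rfl
  norm_sq x := by simp
  parallelogram x y hx hy := by
    rw [LinearMap.id_apply] at hx hy
    simp [hx, hy]

/-- A subspace that contains the first summand is an extension of it, by a smaller space. -/
def comap {Y : Type w} [NormedAddCommGroup Y] [NormedSpace 𝕜 Y] (f : Y →ₗᵢ[𝕜] X)
    (g : F →ₗᵢ[𝕜] Y) (h : ∀ e, f (g e) = A.incl e) : HilbertExtension 𝕜 F Y where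
  incl := g
  proj := A.proj ∘ₗ f.toLinearMap
  proj_incl e := by simp [h, A.proj_incl]
  norm_sq y := by
    have := A.norm_sq (f y)
    rw [← h, ← map_sub, f.norm_map, f.norm_map] at this
    exact this
  parallelogram x y hx hy := by
    simpa only [← map_add, ← map_sub, f.norm_map] using A.parallelogram (f x) (f y) hx hy

end Basic

/-! ### Stability of Hilbert extensions under ultrapowers. -/

section Ultrapower

variable {𝕜 : Type uK} [RCLike 𝕜] {I : Type v} {𝒰 : Ultrafilter I}
  {E : ℕ → Type u} [∀ n, NormedAddCommGroup (E n)] [∀ n, NormedSpace 𝕜 (E n)]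
  {X : Type w} [NormedAddCommGroup X] [NormedSpace 𝕜 X]

theorem exists_coordinatewise_limit [∀ n, FiniteDimensional 𝕜 (E n)] (𝒰 : Ultrafilter I)
    {q : I → lp E 2} {C : ℝ} (hq : ∀ i, ‖q i‖ ≤ C) :
    ∃ e : lp E 2, ∀ n, Tendsto (fun i => q i n) (𝒰 : Filter I) (𝓝 (e n)) := by
  have : ∀ n, ProperSpace (E n) := fun n => FiniteDimensional.proper_rclike 𝕜 (E n)
  choose e he using fun n => 𝒰.exists_tendsto_of_norm_le (f := fun i => q i n)
    fun i => (lp.norm_apply_le_norm two_ne_zero (q i) n).trans (hq i)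
  refine ⟨⟨e, lp.memℓp_of_tendsto (F := q) (l := (𝒰 : Filter I)) ?_ (tendsto_pi_nhds.2 he)⟩, he⟩
  exact isBounded_iff_forall_norm_le.2 ⟨C, by rintro _ ⟨i, rfl⟩; exact hq i⟩

/-- In the limit, the norm splits between a coordinatewise limit and the remainder. -/
theorem tendsto_norm_sq_sub_norm_sq {q : I → lp E 2} {C : ℝ} (hq : ∀ i, ‖q i‖ ≤ C) {e : lp E 2}
    (he : ∀ n, Tendsto (fun i => q i n) (𝒰 : Filter I) (𝓝 (e n))) :
    Tendsto (fun i => ‖q i‖ ^ 2 - ‖q i - e‖ ^ 2) (𝒰 : Filter I) (𝓝 (‖e‖ ^ 2)) := by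
  have hlim : ∀ d : lp E 2, ∃ b, Tendsto (fun i => ‖q i - d‖) (𝒰 : Filter I) (𝓝 b) := fun d =>
    𝒰.exists_tendsto_of_norm_le (C := C + ‖d‖) fun i => by
      rw [norm_norm]; exact (norm_sub_le _ _).trans (add_le_add_left (hq i) _)
  obtain ⟨a, ha⟩ := hlim 0
  simp only [sub_zero] at ha
  choose b hb using hlim
  -- For a truncation of `e` the difference of squares is a finite sum over coordinates, each of
  -- which converges. The limit distance `b` is 1-Lipschitz, which carries the identity over to `e`.
  have hS : ∀ S : Finset ℕ, a ^ 2 - b (lp.truncate S e) ^ 2 = ‖lp.truncate S e‖ ^ 2 := fun S => by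
    refine tendsto_nhds_unique ((ha.pow 2).sub ((hb _).pow 2)) ?_
    simp only [lp.norm_sq_sub_norm_sq_sub_truncate, lp.norm_sq_truncate]
    refine tendsto_finsetSum _ fun n _ => ?_
    simpa using ((he n).norm.pow 2).sub (((he n).sub_const (e n)).norm.pow 2)
  have hlip : ∀ d d', ‖b d - b d'‖ ≤ ‖d - d'‖ := fun d d' => by
    refine le_of_tendsto' ((hb d).sub (hb d')).norm fun i => ?_
    rw [Real.norm_eq_abs]
    refine (abs_norm_sub_norm_le _ _).trans_eq ?_
    rw [sub_sub_sub_cancel_left, norm_sub_rev]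
  have hbS : Tendsto (fun S => b (lp.truncate S e)) atTop (𝓝 (b e)) := by
    refine tendsto_iff_norm_sub_tendsto_zero.2 (squeeze_zero (fun _ => norm_nonneg _)
      (fun S => hlip _ _) ?_)
    exact tendsto_iff_norm_sub_tendsto_zero.1 (lp.tendsto_truncate e)
  have hfin : a ^ 2 - b e ^ 2 = ‖e‖ ^ 2 := by
    refine tendsto_nhds_unique (tendsto_const_nhds.sub (hbS.pow 2)) ?_
    simp only [hS]
    exact (lp.tendsto_truncate e).norm.pow 2
  rw [← hfin]
  exact (ha.pow 2).sub ((hb e).pow 2)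

/-- The parallelogram law holds in the limit for families that vanish coordinatewise, if it holds
asymptotically in the summands. -/
theorem parallelogram_le_of_tendsto_zero
    (hE : ∀ c : ℝ, c < 1 → ∀ᶠ n in atTop, ∀ x y : E n,
      2 * c * (‖x‖ ^ 2 + ‖y‖ ^ 2) ≤ ‖x + y‖ ^ 2 + ‖x - y‖ ^ 2)
    {q r : I → lp E 2}
    (hq0 : ∀ n, Tendsto (fun i => q i n) (𝒰 : Filter I) (𝓝 0))
    (hr0 : ∀ n, Tendsto (fun i => r i n) (𝒰 : Filter I) (𝓝 0))
    {a b s d : ℝ} (ha : Tendsto (fun i => ‖q i‖ ^ 2) (𝒰 : Filter I) (𝓝 a))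
    (hb : Tendsto (fun i => ‖r i‖ ^ 2) (𝒰 : Filter I) (𝓝 b))
    (hs : Tendsto (fun i => ‖q i + r i‖ ^ 2) (𝒰 : Filter I) (𝓝 s))
    (hd : Tendsto (fun i => ‖q i - r i‖ ^ 2) (𝒰 : Filter I) (𝓝 d)) :
    2 * (a + b) ≤ s + d := by
  have key : ∀ c : ℝ, 0 < c → c < 1 → 2 * c * (a + b) ≤ s + d := fun c hc0 hc => by
    -- From `N` on the inequality holds up to the factor `c`. The coordinates below `N` tend to `0`,
    -- so their part of the left side can be discarded in the limit.
    obtain ⟨N, hN⟩ := eventually_atTop.1 (hE c hc)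
    let S := Finset.range N
    have h0 : Tendsto (fun i => ∑ n ∈ S, 2 * c * (‖q i n‖ ^ 2 + ‖r i n‖ ^ 2))
        (𝒰 : Filter I) (𝓝 0) := by
      have := tendsto_finsetSum S fun n _ =>
        (((hq0 n).norm.pow 2).add ((hr0 n).norm.pow 2)).const_mul (2 * c)
      simpa using this
    have h1 := ((ha.add hb).const_mul (2 * c)).sub h0
    rw [sub_zero] at h1
    refine le_of_tendsto_of_tendsto' h1 (hs.add hd) fun i => ?_
    have hsum : HasSum (fun n => if n ∈ S then 2 * c * (‖q i n‖ ^ 2 + ‖r i n‖ ^ 2) else 0)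
        (∑ n ∈ S, 2 * c * (‖q i n‖ ^ 2 + ‖r i n‖ ^ 2)) := by
      rw [← Finset.sum_congr rfl fun n hn => if_pos hn]
      exact hasSum_sum_of_ne_finset_zero fun n hn => if_neg hn
    refine hasSum_le (fun n => ?_) ((((lp.hasSum_norm_sq (q i)).add
      (lp.hasSum_norm_sq (r i))).mul_left (2 * c)).sub hsum)
      ((lp.hasSum_norm_sq (q i + r i)).add (lp.hasSum_norm_sq (q i - r i)))
    split_ifs with h
    · rw [sub_self]; positivity
    · rw [sub_zero]
      exact hN n (by simpa [S] using h) (q i n) (r i n)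
  have hlim : Tendsto (fun c : ℝ => 2 * c * (a + b)) (𝓝[<] 1) (𝓝 (2 * 1 * (a + b))) :=
    ((tendsto_const_nhds.mul tendsto_id).mul_const _).mono_left nhdsWithin_le_nhds
  rw [← mul_one 2]
  refine le_of_tendsto hlim ?_
  filter_upwards [Ioo_mem_nhdsLT one_pos] with c hc using key c hc.1 hc.2

variable [∀ n, FiniteDimensional 𝕜 (E n)] (A : HilbertExtension 𝕜 (lp E 2) X)

theorem exists_ultraProj (𝒰 : Ultrafilter I) (x : lp (fun _ : I => X) ∞) :
    ∃ e : lp E 2, ∀ n, Tendsto (fun i => A.proj (x i) n) (𝒰 : Filter I) (𝓝 (e n)) :=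
  exists_coordinatewise_limit (𝕜 := 𝕜) 𝒰
    fun i => (A.norm_proj_le _).trans (lp.norm_apply_le x i)

/-- The coordinatewise limit of the projections of a bounded family. -/
noncomputable def familyProj (𝒰 : Ultrafilter I) : lp (fun _ : I => X) ∞ →ₗ[𝕜] lp E 2 where
  toFun x := (A.exists_ultraProj 𝒰 x).choose
  map_add' x y := by
    ext n
    refine tendsto_nhds_unique ((A.exists_ultraProj 𝒰 (x + y)).choose_spec n) ?_
    simpa using ((A.exists_ultraProj 𝒰 x).choose_spec n).add
      ((A.exists_ultraProj 𝒰 y).choose_spec n)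
  map_smul' c x := by
    ext n
    refine tendsto_nhds_unique ((A.exists_ultraProj 𝒰 (c • x)).choose_spec n) ?_
    simpa using ((A.exists_ultraProj 𝒰 x).choose_spec n).const_smul c

theorem tendsto_familyProj (𝒰 : Ultrafilter I) (x : lp (fun _ : I => X) ∞) (n : ℕ) :
    Tendsto (fun i => A.proj (x i) n) (𝒰 : Filter I) (𝓝 (A.familyProj 𝒰 x n)) :=
  (A.exists_ultraProj 𝒰 x).choose_spec n

theorem familyProj_eq {x : lp (fun _ : I => X) ∞} {e : lp E 2}
    (h : ∀ n, Tendsto (fun i => A.proj (x i) n) (𝒰 : Filter I) (𝓝 (e n))) :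
    A.familyProj 𝒰 x = e := by
  ext n
  exact tendsto_nhds_unique (A.tendsto_familyProj 𝒰 x n) (h n)

/-- The projection of an ultrapower of `X` onto the first summand of `X`. -/
noncomputable def ultraProj (𝒰 : Ultrafilter I) : Ultrapower 𝕜 𝒰 X →ₗ[𝕜] lp E 2 :=
  (nullFamilies 𝕜 𝒰 X).liftQ (A.familyProj 𝒰) fun x hx => by
    refine LinearMap.mem_ker.2 (A.familyProj_eq fun n => ?_)
    refine squeeze_zero_norm (fun i => ?_) (tendsto_zero_iff_norm_tendsto_zero.1
      (mem_nullFamilies.1 hx))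
    exact (lp.norm_apply_le_norm two_ne_zero _ n).trans (A.norm_proj_le _)

theorem ultraProj_ultraMk (x : lp (fun _ : I => X) ∞) :
    A.ultraProj 𝒰 (ultraMk 𝕜 𝒰 x) = A.familyProj 𝒰 x := rfl

theorem ultraProj_diag_incl (e : lp E 2) :
    A.ultraProj 𝒰 (ultraDiag 𝕜 𝒰 X (A.incl e)) = e := by
  rw [ultraDiag_apply, ultraProj_ultraMk]
  refine A.familyProj_eq fun n => ?_
  simp [A.proj_incl]

/-- Subtracting a vector of the first summand leaves the Hilbert component unchanged, so the
difference of squared norms is that of the projections, and `tendsto_norm_sq_sub_norm_sq` applies.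
-/
theorem ultra_norm_sq (z : Ultrapower 𝕜 𝒰 X) :
    ‖z‖ ^ 2 = ‖A.ultraProj 𝒰 z‖ ^ 2 +
      ‖z - ultraDiag 𝕜 𝒰 X (A.incl (A.ultraProj 𝒰 z))‖ ^ 2 := by
  obtain ⟨x, rfl⟩ := ultraMk_surjective z
  rw [← sub_eq_iff_eq_add]
  set e := A.ultraProj 𝒰 (ultraMk 𝕜 𝒰 x) with he
  rw [ultraDiag_apply, ← map_sub]
  refine tendsto_nhds_unique (((tendsto_norm_ultraMk x).pow 2).sub
    ((tendsto_norm_ultraMk _).pow 2)) ?_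
  refine (tendsto_norm_sq_sub_norm_sq (q := fun i => A.proj (x i)) (C := ‖x‖)
    (fun i => (A.norm_proj_le _).trans (lp.norm_apply_le x i))
    fun n => A.tendsto_familyProj 𝒰 x n).congr fun i => ?_
  rw [A.norm_sq_eq (x i)]
  have h := A.norm_sq_eq (x i - A.incl e)
  rw [map_sub, map_sub, A.proj_incl, A.rest_incl, sub_zero] at h
  simp only [lp.coeFn_sub, Pi.sub_apply, lp.ofBound_apply, h]
  rw [he, ultraProj_ultraMk]
  ring

/-- The Hilbert components obey the law exactly, also in the limit; the projections vanish
coordinatewise in the limit and obey the inequality by `parallelogram_le_of_tendsto_zero`. -/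
theorem ultra_parallelogram_le
    (hE : ∀ c : ℝ, c < 1 → ∀ᶠ n in atTop, ∀ x y : E n,
      2 * c * (‖x‖ ^ 2 + ‖y‖ ^ 2) ≤ ‖x + y‖ ^ 2 + ‖x - y‖ ^ 2)
    (z w : Ultrapower 𝕜 𝒰 X) (hz : A.ultraProj 𝒰 z = 0) (hw : A.ultraProj 𝒰 w = 0) :
    2 * (‖z‖ ^ 2 + ‖w‖ ^ 2) ≤ ‖z + w‖ ^ 2 + ‖z - w‖ ^ 2 := by
  obtain ⟨x, rfl⟩ := ultraMk_surjective z
  obtain ⟨y, rfl⟩ := ultraMk_surjective w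
  have hlim : ∀ x : lp (fun _ : I => X) ∞,
      ∃ a, Tendsto (fun i => ‖A.proj (x i)‖) (𝒰 : Filter I) (𝓝 a) := fun x =>
    𝒰.exists_tendsto_of_norm_le (C := ‖x‖) fun i => by
      rw [norm_norm]; exact (A.norm_proj_le _).trans (lp.norm_apply_le x i)
  choose a ha using hlim
  have hx0 := A.tendsto_familyProj 𝒰 x
  have hy0 := A.tendsto_familyProj 𝒰 y
  rw [← ultraProj_ultraMk, hz] at hx0
  rw [← ultraProj_ultraMk, hw] at hy0
  have hrest : ∀ x : lp (fun _ : I => X) ∞, Tendsto (fun i => ‖A.rest (x i)‖ ^ 2) (𝒰 : Filter I)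
      (𝓝 (‖ultraMk 𝕜 𝒰 x‖ ^ 2 - a x ^ 2)) := fun x => by
    refine (((tendsto_norm_ultraMk x).pow 2).sub ((ha x).pow 2)).congr fun i => ?_
    rw [A.norm_sq_eq (x i)]; ring
  have h1 := parallelogram_le_of_tendsto_zero hE hx0 hy0 ((ha x).pow 2) ((ha y).pow 2)
    (s := a (x + y) ^ 2) (d := a (x - y) ^ 2)
    (((ha (x + y)).pow 2).congr fun i => by simp) (((ha (x - y)).pow 2).congr fun i => by simp)
  have h2 : (‖ultraMk 𝕜 𝒰 (x + y)‖ ^ 2 - a (x + y) ^ 2) +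
      (‖ultraMk 𝕜 𝒰 (x - y)‖ ^ 2 - a (x - y) ^ 2) =
      2 * ((‖ultraMk 𝕜 𝒰 x‖ ^ 2 - a x ^ 2) + (‖ultraMk 𝕜 𝒰 y‖ ^ 2 - a y ^ 2)) := by
    refine tendsto_nhds_unique ((hrest (x + y)).add (hrest (x - y))) ?_
    refine (((hrest x).add (hrest y)).const_mul 2).congr fun i => ?_
    exact (A.parallelogram_rest (x i) (y i)).symm
  rw [← map_add, ← map_sub]
  linarith

/-- An ultrapower of a Hilbert extension of `ℓ₂(E)` is one as well, if the parallelogram law holds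
asymptotically in the finite dimensional summands. -/
noncomputable def ultrapower (𝒰 : Ultrafilter I)
    (hE : ∀ c : ℝ, c < 1 → ∀ᶠ n in atTop, ∀ x y : E n,
      2 * c * (‖x‖ ^ 2 + ‖y‖ ^ 2) ≤ ‖x + y‖ ^ 2 + ‖x - y‖ ^ 2) :
    HilbertExtension 𝕜 (lp E 2) (Ultrapower 𝕜 𝒰 X) where
  incl := (ultraDiag 𝕜 𝒰 X).comp A.incl
  proj := A.ultraProj 𝒰
  proj_incl := A.ultraProj_diag_incl
  norm_sq := A.ultra_norm_sq
  parallelogram z w hz hw := by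
    refine le_antisymm ?_ (A.ultra_parallelogram_le hE z w hz hw)
    -- The sum and difference of `z + w` and `z - w` are `2z` and `2w`, so this is the reverse
    -- inequality.
    have h := A.ultra_parallelogram_le hE (z + w) (z - w)
      (by rw [map_add, hz, hw, add_zero]) (by rw [map_sub, hz, hw, sub_zero])
    rw [add_add_sub_cancel, add_sub_sub_cancel, ← two_smul 𝕜 z, ← two_smul 𝕜 w, norm_smul,
      norm_smul, RCLike.norm_two] at h
    linarith

end Ultrapower

end HilbertExtension

/-! ### Comparing powers of a small parameter. -/

section RealInequalities

/-- Convexity of the power: its graph lies above the tangent at `x`. This is Bernoulli's inequality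
for `y / x`. -/
theorem Real.rpow_sub_rpow_le {x y r : ℝ} (hx : 0 < x) (hy : 0 ≤ y) (hr : 1 ≤ r) :
    x ^ r - y ^ r ≤ r * x ^ (r - 1) * (x - y) := by
  have h1 : 1 + r * (y / x - 1) ≤ (1 + (y / x - 1)) ^ r :=
    one_add_mul_self_le_rpow_one_add (by linarith [div_nonneg hy hx.le]) hr
  rw [add_sub_cancel, Real.div_rpow hy hx.le, le_div_iff₀ (Real.rpow_pos_of_pos hx r)] at h1
  have h2 : x ^ (r - 1) * x = x ^ r := by
    rw [← Real.rpow_add_one hx.ne', sub_add_cancel]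
  have h3 : (1 + r * (y / x - 1)) * x ^ r = x ^ r + r * x ^ (r - 1) * (y - x) := by
    rw [← h2]; field_simp
  rw [h3] at h1
  linarith

theorem Real.eq_zero_of_forall_le_const_mul_rpow {b C s : ℝ} (hb : 0 ≤ b) (hs : 0 < s)
    (h : ∀ t : ℝ, 0 < t → t < 1 → b ≤ C * t ^ s) : b = 0 := by
  have h0 : Tendsto (fun t : ℝ => C * t ^ s) (𝓝[>] 0) (𝓝 (C * 0 ^ s)) :=
    ((Real.continuousAt_rpow_const 0 s (Or.inr hs.le)).tendsto.const_mul C).mono_left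
      nhdsWithin_le_nhds
  rw [Real.zero_rpow hs.ne', mul_zero] at h0
  refine le_antisymm (ge_of_tendsto h0 ?_) hb
  filter_upwards [Ioo_mem_nhdsGT one_pos] with t ht using h t ht.1 ht.2

theorem Real.eq_zero_of_sq_mul_le_rpow {b p : ℝ} (hb : 0 ≤ b) (hp : 2 < p)
    (h : ∀ t : ℝ, 0 < t → t < 1 → t ^ 2 * b ≤ t ^ p) : b = 0 := by
  refine Real.eq_zero_of_forall_le_const_mul_rpow (C := 1) hb (sub_pos.2 hp) fun t ht ht1 => ?_
  rw [one_mul, Real.rpow_sub ht, Real.rpow_two, le_div_iff₀ (by positivity), mul_comm]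
  exact h t ht ht1

/-- Raising to the power `q / 2` and linearizing at `a ^ 2 + t ^ p ≤ 2` gives `(t * b) ^ q ≤ C * t ^
p`, hence `b ^ q ≤ C * t ^ (p - q)`, which tends to `0` with `t`. -/
theorem Real.eq_zero_of_rpow_sum_le {a b p q : ℝ} (ha : 0 ≤ a) (ha1 : a ≤ 1) (hb : 0 ≤ b)
    (hq : 2 < q) (hqp : q < p)
    (h : ∀ t : ℝ, 0 < t → t < 1 → (a ^ q + (t * b) ^ q) ^ (2 / q) ≤ a ^ 2 + t ^ p) : b = 0 := by
  have hq0 : 0 < q := by linarith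
  suffices hb' : b ^ q = 0 from (Real.rpow_eq_zero hb hq0.ne').1 hb'
  refine Real.eq_zero_of_forall_le_const_mul_rpow (C := q / 2 * 2 ^ (q / 2 - 1))
    (by positivity) (sub_pos.2 hqp) fun t ht ht1 => ?_
  have htp : t ^ p ≤ 1 := Real.rpow_le_one ht.le ht1.le (by linarith)
  have htp0 : 0 < t ^ p := Real.rpow_pos_of_pos ht p
  have h1 : a ^ q + (t * b) ^ q ≤ (a ^ 2 + t ^ p) ^ (q / 2) := by
    have := Real.rpow_le_rpow (by positivity) (h t ht ht1) (show 0 ≤ q / 2 by positivity)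
    rwa [← Real.rpow_mul (by positivity), div_mul_div_cancel₀ hq0.ne', div_self two_ne_zero,
      Real.rpow_one] at this
  have h2 := Real.rpow_sub_rpow_le (x := a ^ 2 + t ^ p) (y := a ^ 2) (r := q / 2)
    (by positivity) (by positivity) (by linarith)
  have h3 : (a ^ 2) ^ (q / 2) = a ^ q := by
    rw [← Real.rpow_two, ← Real.rpow_mul ha]; congr 1; ring
  have h4 : (a ^ 2 + t ^ p) ^ (q / 2 - 1) ≤ 2 ^ (q / 2 - 1) :=
    Real.rpow_le_rpow (by positivity) (by nlinarith) (by linarith)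
  have h5 : q / 2 * (a ^ 2 + t ^ p) ^ (q / 2 - 1) * t ^ p ≤ q / 2 * 2 ^ (q / 2 - 1) * t ^ p := by
    gcongr
  rw [h3, add_sub_cancel_left] at h2
  rw [Real.mul_rpow ht.le hb] at h1
  rw [Real.rpow_sub ht, ← mul_div_assoc, le_div_iff₀ (by positivity), mul_comm]
  linarith

end RealInequalities

theorem two_mul_norm_sq_le {F : Type*} [SeminormedAddCommGroup F] [NormedSpace ℝ F] (x y : F) :
    2 * ‖x‖ ^ 2 ≤ ‖x + y‖ ^ 2 + ‖x - y‖ ^ 2 := by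
  have h : ‖(2 : ℝ) • x‖ ≤ ‖x + y‖ + ‖x - y‖ := by
    rw [two_smul, ← add_add_sub_cancel x x y]
    exact norm_add_le _ _
  rw [norm_smul, Real.norm_two] at h
  nlinarith [sq_nonneg (‖x + y‖ - ‖x - y‖), norm_nonneg x]

/-! ### Norm estimates for `ℓ_p`-pairs. -/

namespace IsEllPair

variable {𝕜 : Type uK} [RCLike 𝕜] {X : Type u} [NormedAddCommGroup X] [NormedSpace 𝕜 X]
  {p : ℝ} {x y : X}

theorem norm_left (h : IsEllPair 𝕜 p x y) (hp : 2 < p) : ‖x‖ = 1 := by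
  have := h 0
  rw [RCLike.ofReal_zero, zero_smul, add_zero, abs_zero, Real.zero_rpow (by linarith),
    add_zero] at this
  exact (Real.rpow_left_inj (norm_nonneg x) zero_le_one (by linarith)).1
    (this.trans (Real.one_rpow p).symm)

/-- The square is `(1 + |t| ^ p) ^ (2 / p)`, with base at least `1` and exponent at most `1`. -/
theorem norm_sq_le (h : IsEllPair 𝕜 p x y) (hp : 2 < p) (t : ℝ) :
    ‖x + (t : 𝕜) • y‖ ^ 2 ≤ 1 + |t| ^ p := by
  have h1 : (1 : ℝ) ≤ 1 + |t| ^ p := by linarith [Real.rpow_nonneg (abs_nonneg t) p]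
  have h2 : ‖x + (t : 𝕜) • y‖ ^ 2 = (1 + |t| ^ p) ^ (2 / p) := by
    rw [← h t, ← Real.rpow_mul (norm_nonneg _), mul_div_cancel₀ _ (by linarith), Real.rpow_two]
  rw [h2]
  exact (Real.rpow_le_rpow_of_exponent_le h1 ((div_le_one (by linarith)).2 hp.le)).trans_eq
    (Real.rpow_one _)

theorem map {Y : Type v} [NormedAddCommGroup Y] [NormedSpace 𝕜 Y] (h : IsEllPair 𝕜 p x y)
    (f : X →ₗ[𝕜] Y) (hf : ∀ x, ‖f x‖ = ‖x‖) : IsEllPair 𝕜 p (f x) (f y) := fun t => by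
  rw [← map_smul, ← map_add, hf]
  exact h t

end IsEllPair

/-! ### Rigidity of the first summand. -/

namespace HilbertExtension

section Embedding

variable {𝕜 : Type uK} [RCLike 𝕜]
  {E : ℕ → Type u} [∀ n, NormedAddCommGroup (E n)] [∀ n, NormedSpace 𝕜 (E n)]
  {X : Type w} [NormedAddCommGroup X] [NormedSpace 𝕜 X] (A : HilbertExtension 𝕜 (lp E 2) X)
  {p : ℕ → ℝ}

theorem hasSum_ellPair (u v : X) :
    HasSum (fun m => ‖A.proj u m + A.proj v m‖ ^ 2 + ‖A.proj u m - A.proj v m‖ ^ 2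
      - 2 * ‖A.proj u m‖ ^ 2)
      (‖u + v‖ ^ 2 + ‖u - v‖ ^ 2 - 2 * ‖u‖ ^ 2 - 2 * ‖A.rest v‖ ^ 2) := by
  have h := ((lp.hasSum_norm_sq (A.proj (u + v))).add (lp.hasSum_norm_sq (A.proj (u - v)))).sub
    ((lp.hasSum_norm_sq (A.proj u)).mul_left 2)
  have h1 : ‖u + v‖ ^ 2 + ‖u - v‖ ^ 2 - 2 * ‖u‖ ^ 2 - 2 * ‖A.rest v‖ ^ 2 =
      ‖A.proj (u + v)‖ ^ 2 + ‖A.proj (u - v)‖ ^ 2 - 2 * ‖A.proj u‖ ^ 2 := by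
    rw [A.norm_sq_eq (u + v), A.norm_sq_eq (u - v), A.norm_sq_eq u]
    linarith [A.parallelogram_rest u v]
  rw [h1]
  simpa using h

/-- The second vector of an `ℓ_r`-pair lies in the sum of the `E m` with `p m ≥ r`. -/
theorem rest_eq_zero_and_proj_apply_eq_zero (hp : ∀ n, 2 < p n)
    (ha : ∀ (n : ℕ) (x y : E n),
      2 * (‖x‖ ^ p n + ‖y‖ ^ p n) ^ (2 / p n) ≤ ‖x + y‖ ^ 2 + ‖x - y‖ ^ 2)
    {r : ℝ} (hr : 2 < r) {u v : X} (huv : IsEllPair 𝕜 r u v) :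
    A.rest v = 0 ∧ ∀ m, p m < r → A.proj v m = 0 := by
  have hu := huv.norm_left hr
  have hbound : ∀ t : ℝ, 0 < t → ‖u + (t : 𝕜) • v‖ ^ 2 + ‖u - (t : 𝕜) • v‖ ^ 2 - 2 * ‖u‖ ^ 2 ≤
      2 * t ^ r := fun t ht => by
    have h1 := huv.norm_sq_le hr t
    have h2 := huv.norm_sq_le hr (-t)
    rw [RCLike.ofReal_neg, neg_smul, ← sub_eq_add_neg, abs_neg] at h2
    rw [abs_of_pos ht] at h1 h2
    rw [hu]
    linarith
  -- As no coordinate contributes negatively, the bound `2 * t ^ r` on the total holds for each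
  -- contribution separately.
  have hnonneg : ∀ (w : X) m, 0 ≤ ‖A.proj u m + A.proj w m‖ ^ 2 +
      ‖A.proj u m - A.proj w m‖ ^ 2 - 2 * ‖A.proj u m‖ ^ 2 := fun w m => by
    let _ : NormedSpace ℝ (E m) := NormedSpace.restrictScalars ℝ 𝕜 (E m)
    linarith [two_mul_norm_sq_le (A.proj u m) (A.proj w m)]
  constructor
  · suffices h : ‖A.rest v‖ ^ 2 = 0 by simpa using h
    refine Real.eq_zero_of_sq_mul_le_rpow (by positivity) hr fun t ht _ => ?_
    have h1 := (A.hasSum_ellPair u ((t : 𝕜) • v)).nonneg (hnonneg _)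
    have h2 := hbound t ht
    rw [map_smul, norm_smul, RCLike.norm_ofReal, abs_of_pos ht, mul_pow] at h1
    linarith
  · intro m hm
    rw [← norm_eq_zero]
    refine Real.eq_zero_of_rpow_sum_le (a := ‖A.proj u m‖) (norm_nonneg _) ?_ (norm_nonneg _)
      (hp m) hm fun t ht _ => ?_
    · rw [← hu]
      exact (lp.norm_apply_le_norm two_ne_zero _ m).trans (A.norm_proj_le u)
    · have h1 := le_hasSum (A.hasSum_ellPair u ((t : 𝕜) • v)) m fun j _ => hnonneg _ j
      have h2 := hbound t ht
      have h3 := ha m (A.proj u m) (A.proj ((t : 𝕜) • v) m)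
      have h4 : ‖A.proj ((t : 𝕜) • v) m‖ = t * ‖A.proj v m‖ := by
        rw [map_smul, lp.coeFn_smul, Pi.smul_apply, norm_smul, RCLike.norm_ofReal, abs_of_pos ht]
      rw [h4] at h3
      nlinarith [sq_nonneg ‖A.rest ((t : 𝕜) • v)‖]

variable (𝕜 E p) in
/-- The sum of the `E m` with `p m ≥ r`. -/
def largeExponents (r : ℝ) : Submodule 𝕜 (lp E 2) where
  carrier := {x | ∀ m, p m < r → x m = 0}
  zero_mem' _ _ := rfl
  add_mem' hx hy m hm := by simp [hx m hm, hy m hm]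
  smul_mem' c x hx m hm := by simp [hx m hm]

theorem mem_largeExponents {r : ℝ} {x : lp E 2} :
    x ∈ largeExponents 𝕜 E p r ↔ ∀ m, p m < r → x m = 0 := Iff.rfl

theorem single_mem_largeExponents (n : ℕ) (y : E n) :
    lp.single 2 n y ∈ largeExponents 𝕜 E p (p n) := fun m hm => by
  rw [lp.single_apply_ne]
  rintro rfl
  exact lt_irrefl _ hm

theorem finite_setOf_le_exponent (hlim : Tendsto p atTop (𝓝 2)) {r : ℝ} (hr : 2 < r) :
    {m | r ≤ p m}.Finite := by
  obtain ⟨N, hN⟩ := eventually_atTop.1 (hlim.eventually_lt_const hr)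
  refine (Set.finite_lt_nat N).subset fun m hm => ?_
  by_contra h
  exact absurd (hN m (not_lt.1 h)) (not_lt.2 hm)

theorem finiteDimensional_largeExponents [∀ n, FiniteDimensional 𝕜 (E n)]
    (hlim : Tendsto p atTop (𝓝 2)) {r : ℝ} (hr : 2 < r) :
    FiniteDimensional 𝕜 (largeExponents 𝕜 E p r) := by
  have := (finite_setOf_le_exponent hlim hr).to_subtype
  let f : largeExponents 𝕜 E p r →ₗ[𝕜] ∀ m : {m | r ≤ p m}, E m :=
    { toFun := fun x m => x.1 m
      map_add' := fun x y => by ext; simp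
      map_smul' := fun c x => by ext; simp }
  refine FiniteDimensional.of_injective f fun x y hxy => ?_
  ext m
  rcases lt_or_ge (p m) r with h | h
  · rw [x.2 m h, y.2 m h]
  · exact congrFun hxy ⟨m, h⟩

theorem largeExponents_anti {r s : ℝ} (h : s ≤ r) :
    largeExponents 𝕜 E p r ≤ largeExponents 𝕜 E p s := fun _ hx m hm => hx m (hm.trans_le h)

variable (hp : ∀ n, 2 < p n)
    (ha : ∀ (n : ℕ) (x y : E n),
      2 * (‖x‖ ^ p n + ‖y‖ ^ p n) ^ (2 / p n) ≤ ‖x + y‖ ^ 2 + ‖x - y‖ ^ 2)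
    (hb : ∀ n : ℕ, ∃ (d : ℕ) (b : Module.Basis (Fin d) 𝕜 (E n)),
      ∀ j, ∃ i, IsEllPair 𝕜 (p n) (b i) (b j))

-- By (b) the `E n` are spanned by second vectors of `ℓ_{p n}`-pairs, and isometries preserve such
-- pairs.
include hp ha hb in
theorem map_single_mem (T : lp E 2 →ₗᵢ[𝕜] X) (n : ℕ) (y : E n) :
    T (lp.single 2 n y) ∈ (largeExponents 𝕜 E p (p n)).map A.incl.toLinearMap := by
  obtain ⟨d, b, hpair⟩ := hb n
  let s : E n →ₗ[𝕜] lp E 2 :=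
    { toFun := lp.single 2 n
      map_add' := lp.single_add 2 n
      map_smul' := lp.single_smul 2 n }
  have hs : ⊤ ≤ ((largeExponents 𝕜 E p (p n)).map A.incl.toLinearMap).comap
      (T.toLinearMap ∘ₗ s) := by
    rw [← b.span_eq, Submodule.span_le]
    rintro _ ⟨j, rfl⟩
    obtain ⟨i, hij⟩ := hpair j
    have h := A.rest_eq_zero_and_proj_apply_eq_zero hp ha (hp n)
      (hij.map (T.toLinearMap ∘ₗ s) fun x => by
        simp [s])
    refine ⟨_, mem_largeExponents.2 h.2, ?_⟩
    have h1 := A.incl_proj_add_rest ((T.toLinearMap ∘ₗ s) (b j))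
    rwa [h.1, add_zero] at h1
  exact hs (Submodule.mem_top (x := y))

-- One image lies in the other, and both have the finite dimension of `largeExponents`, as `T` and
-- `A.incl` are injective.
include hp ha hb in
theorem map_largeExponents [∀ n, FiniteDimensional 𝕜 (E n)] (hlim : Tendsto p atTop (𝓝 2))
    (T : lp E 2 →ₗᵢ[𝕜] X) {r : ℝ} (hr : 2 < r) :
    (largeExponents 𝕜 E p r).map T.toLinearMap =
      (largeExponents 𝕜 E p r).map A.incl.toLinearMap := by
  have := finiteDimensional_largeExponents (𝕜 := 𝕜) (E := E) hlim hr
  refine Submodule.eq_of_le_of_finrank_eq ?_ ?_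
  · rintro _ ⟨x, hx, rfl⟩
    have hS := finite_setOf_le_exponent hlim hr
    have hx' : x = lp.truncate hS.toFinset x := by
      ext m
      rw [lp.truncate_apply]
      split_ifs with h
      · rfl
      · exact hx m (by simpa using h)
    rw [hx', lp.truncate, map_sum]
    refine Submodule.sum_mem _ fun m hm => ?_
    exact Submodule.map_mono (largeExponents_anti (by simpa using hm))
      (A.map_single_mem hp ha hb T m (x m))
  · rw [← (Submodule.equivMapOfInjective _ T.injective _).finrank_eq,
      ← (Submodule.equivMapOfInjective _ A.incl.injective _).finrank_eq]

theorem range_le_of_single_mem [∀ n, CompleteSpace (E n)] {S T : lp E 2 →ₗᵢ[𝕜] X}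
    (h : ∀ n (y : E n), S (lp.single 2 n y) ∈ T.toLinearMap.range) :
    S.toLinearMap.range ≤ T.toLinearMap.range := by
  rintro _ ⟨x, rfl⟩
  have hcl : IsClosed (Set.range T) := T.isometry.isClosedEmbedding.isClosed_range
  refine hcl.mem_of_tendsto ((S.continuous.tendsto x).comp (lp.tendsto_truncate x))
    (Eventually.of_forall fun F => ?_)
  change S (lp.truncate F x) ∈ T.toLinearMap.range
  rw [lp.truncate, map_sum]
  exact Submodule.sum_mem _ fun n _ => h n (x n)

include hp ha hb in
/-- Every isometric copy of `ℓ₂(E)` in a Hilbert extension of it is its first summand. -/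
theorem range_eq_range_incl [∀ n, FiniteDimensional 𝕜 (E n)] (hlim : Tendsto p atTop (𝓝 2))
    (T : lp E 2 →ₗᵢ[𝕜] X) : T.toLinearMap.range = A.incl.toLinearMap.range := by
  have : ∀ n, CompleteSpace (E n) := fun n => FiniteDimensional.complete 𝕜 (E n)
  refine le_antisymm (range_le_of_single_mem fun n y => ?_) (range_le_of_single_mem fun n y => ?_)
  · exact LinearMap.map_le_range (A.map_single_mem hp ha hb T n y)
  · refine LinearMap.map_le_range (p := largeExponents 𝕜 E p (p n)) ?_
    rw [A.map_largeExponents hp ha hb hlim T (hp n)]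
    exact ⟨_, single_mem_largeExponents n y, rfl⟩

end Embedding

end HilbertExtension

/-! ### The asymptotic parallelogram law. -/

/-- The power mean inequality with exponent `p / 2`; the constant tends to `1` as `p` tends to `2`.
-/
theorem Real.sq_add_sq_le_rpow_add_rpow {a b p : ℝ} (ha : 0 ≤ a) (hb : 0 ≤ b) (hp : 2 < p) :
    2 ^ (2 / p - 1) * (a ^ 2 + b ^ 2) ≤ (a ^ p + b ^ p) ^ (2 / p) := by
  have h := NNReal.rpow_add_le_mul_rpow_add_rpow (⟨a ^ 2, by positivity⟩) (⟨b ^ 2, by positivity⟩)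
    (p := p / 2) (by linarith)
  have h1 : (a ^ 2 + b ^ 2) ^ (p / 2) ≤ 2 ^ (p / 2 - 1) * ((a ^ 2) ^ (p / 2) + (b ^ 2) ^ (p / 2)) :=
    by exact_mod_cast h
  have hpow : ∀ {x : ℝ}, 0 ≤ x → (x ^ 2) ^ (p / 2) = x ^ p := fun hx => by
    rw [← Real.rpow_two, ← Real.rpow_mul hx]; congr 1; ring
  rw [hpow ha, hpow hb] at h1
  have h2 := Real.rpow_le_rpow (by positivity) h1 (show 0 ≤ 2 / p by positivity)
  rw [← Real.rpow_mul (by positivity), Real.mul_rpow (by positivity) (by positivity),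
    ← Real.rpow_mul (by positivity), div_mul_div_cancel₀ two_ne_zero, div_self (by linarith),
    Real.rpow_one] at h2
  have h3 : (2 : ℝ) ^ (2 / p - 1) * 2 ^ ((p / 2 - 1) * (2 / p)) = 1 := by
    rw [← Real.rpow_add two_pos, show 2 / p - 1 + (p / 2 - 1) * (2 / p) = 0 by field_simp; ring,
      Real.rpow_zero]
  calc 2 ^ (2 / p - 1) * (a ^ 2 + b ^ 2)
      ≤ 2 ^ (2 / p - 1) * (2 ^ ((p / 2 - 1) * (2 / p)) * (a ^ p + b ^ p) ^ (2 / p)) := by gcongr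
    _ = (a ^ p + b ^ p) ^ (2 / p) := by rw [← mul_assoc, h3, one_mul]

/-- The hypothesis on two-dimensional subspaces gives the parallelogram law asymptotically. -/
theorem asymptotic_parallelogram {E : ℕ → Type u} [∀ n, NormedAddCommGroup (E n)]
    {p : ℕ → ℝ} (hp : ∀ n, 2 < p n) (hlim : Tendsto p atTop (𝓝 2))
    (ha : ∀ (n : ℕ) (x y : E n),
      2 * (‖x‖ ^ p n + ‖y‖ ^ p n) ^ (2 / p n) ≤ ‖x + y‖ ^ 2 + ‖x - y‖ ^ 2)
    (c : ℝ) (hc : c < 1) : ∀ᶠ n in atTop, ∀ x y : E n,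
      2 * c * (‖x‖ ^ 2 + ‖y‖ ^ 2) ≤ ‖x + y‖ ^ 2 + ‖x - y‖ ^ 2 := by
  have h1 : Tendsto (fun n => (2 : ℝ) ^ (2 / p n - 1)) atTop (𝓝 (2 ^ ((2 : ℝ) / 2 - 1))) :=
    ((Real.continuous_const_rpow two_ne_zero).tendsto _).comp
      ((tendsto_const_nhds.div hlim two_ne_zero).sub_const 1)
  rw [div_self two_ne_zero, sub_self, Real.rpow_zero] at h1
  filter_upwards [h1.eventually_const_lt hc] with n hn x y
  refine le_trans ?_ (ha n x y)
  rw [mul_assoc]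
  gcongr
  refine le_trans ?_ (Real.sq_add_sq_le_rpow_add_rpow (norm_nonneg x) (norm_nonneg y) (hp n))
  gcongr

namespace HilbertExtension

/-- A subspace whose range contains the first summand is an extension of it. -/
theorem nonempty_of_incl_mem_range {𝕜 : Type uK} [RCLike 𝕜] {F : Type u} [NormedAddCommGroup F]
    [NormedSpace 𝕜 F] {X : Type v} [NormedAddCommGroup X] [NormedSpace 𝕜 X]
    (A : HilbertExtension 𝕜 F X) {Y : Type w} [NormedAddCommGroup Y] [NormedSpace 𝕜 Y]
    (f : Y →ₗᵢ[𝕜] X) (h : ∀ e, A.incl e ∈ Set.range f) : Nonempty (HilbertExtension 𝕜 F Y) := by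
  choose g hg using h
  exact ⟨A.comap f
    { toFun := g
      map_add' := fun x y => f.injective (by simp [hg])
      map_smul' := fun c x => f.injective (by simp [hg])
      norm_map' := fun x => by
        change ‖g x‖ = ‖x‖
        rw [← f.norm_map, hg, A.incl.norm_map] } hg⟩

/-! ### The elementary class of `ℓ₂(E)`. -/

section ElementaryEquivalence

variable {𝕜 : Type uK} [RCLike 𝕜]
  {E : ℕ → Type u} [∀ n, NormedAddCommGroup (E n)] [∀ n, NormedSpace 𝕜 (E n)]
  [∀ n, FiniteDimensional 𝕜 (E n)] {p : ℕ → ℝ}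

/-- Every Banach space elementarily equivalent to `ℓ₂(E)` is a Hilbert extension of it. -/
theorem nonempty_of_elementarilyEquivalent
    (hp : ∀ n, 2 < p n) (hlim : Tendsto p atTop (𝓝 2))
    (ha : ∀ (n : ℕ) (x y : E n),
      2 * (‖x‖ ^ p n + ‖y‖ ^ p n) ^ (2 / p n) ≤ ‖x + y‖ ^ 2 + ‖x - y‖ ^ 2)
    (hb : ∀ n : ℕ, ∃ (d : ℕ) (b : Module.Basis (Fin d) 𝕜 (E n)),
      ∀ j, ∃ i, IsEllPair 𝕜 (p n) (b i) (b j))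
    {Y : Type u} [NormedAddCommGroup Y] [NormedSpace 𝕜 Y] [CompleteSpace Y]
    (hY : ElementarilyEquivalent 𝕜 (lp E 2) Y) : Nonempty (HilbertExtension 𝕜 (lp E 2) Y) := by
  obtain ⟨I, J, 𝒰, 𝒱, ⟨φ⟩⟩ := hY
  have hE := asymptotic_parallelogram hp hlim ha
  let A := (refl 𝕜 (lp E 2)).ultrapower 𝒰 hE
  let B : HilbertExtension 𝕜 (lp E 2) (Ultrapower 𝕜 𝒱 Y) :=
    A.comap φ.symm.toLinearIsometry (φ.toLinearIsometry.comp A.incl) fun e => by simp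
  refine B.nonempty_of_incl_mem_range (ultraDiag 𝕜 𝒱 Y) fun e => ?_
  have hcl : IsClosed (Set.range (ultraDiag 𝕜 𝒱 Y)) :=
    (ultraDiag 𝕜 𝒱 Y).isometry.isClosedEmbedding.isClosed_range
  -- Rigidity in the second ultrapower compares two copies of `E`: one through the diagonal of
  -- `Y_𝒱`, the other through the ultrapower of the diagonal embedding of `Y`. Equal ranges make the
  -- constant family `B.incl e` agree along `𝒱` with a family from `Y`, and `Y` is closed in `Y_𝒱`.
  have hmem : (B.ultrapower 𝒱 hE).incl e ∈ (B.ultrapower 𝒱 hE).incl.toLinearMap.range := ⟨e, rfl⟩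
  rw [← (B.ultrapower 𝒱 hE).range_eq_range_incl hp ha hb hlim
    ((ultraMap 𝒱 (ultraDiag 𝕜 𝒱 Y)).comp B.incl)] at hmem
  obtain ⟨d, hd⟩ := hmem
  obtain ⟨y, hy⟩ := ultraMk_surjective (B.incl d)
  have h1 : ultraMk 𝕜 𝒱 (lp.mapIsometry (ultraDiag 𝕜 𝒱 Y) y) =
      ultraMk 𝕜 𝒱 (lp.ofBound (fun _ => B.incl e) fun _ => le_rfl) := by
    rw [← ultraMap_ultraMk, hy]
    exact hd
  have h2 : Tendsto (fun i => ultraDiag 𝕜 𝒱 Y (y i) - B.incl e) (𝒱 : Filter J) (𝓝 0) :=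
    mem_nullFamilies.1 ((Submodule.Quotient.eq _).1 h1)
  exact hcl.mem_of_tendsto (tendsto_sub_nhds_zero_iff.1 h2)
    (Eventually.of_forall fun i => ⟨y i, rfl⟩)

end ElementaryEquivalence

/-! ### Splitting off the Hilbert summand. -/

section Decomposition

variable {𝕜 : Type uK} [RCLike 𝕜] {F : Type u} [NormedAddCommGroup F] [NormedSpace 𝕜 F]
  {X : Type v} [NormedAddCommGroup X] [NormedSpace 𝕜 X] (A : HilbertExtension 𝕜 F X)

/-- The Hilbert summand of a Hilbert extension. -/
abbrev hilbert : Submodule 𝕜 X := A.proj.ker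

/-- The inner product of the Hilbert summand. -/
@[reducible] noncomputable def innerProductSpace : InnerProductSpace 𝕜 A.hilbert :=
  InnerProductSpace.ofNorm 𝕜 fun x y => by
    have := A.parallelogram x y x.2 y.2
    simp only [← sq]
    exact this

theorem completeSpace_hilbert [CompleteSpace X] : CompleteSpace A.hilbert := by
  have hcont : Continuous A.proj :=
    AddMonoidHomClass.continuous_of_bound A.proj 1 fun x => by simpa using A.norm_proj_le x
  have hcl : IsClosed (A.hilbert : Set X) := isClosed_singleton.preimage hcont
  exact hcl.completeSpace_coe

/-- The decomposition of a Hilbert extension into its two summands. -/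
noncomputable def decompose : X ≃ₗ[𝕜] F × A.hilbert where
  toFun x := (A.proj x, ⟨A.rest x, A.proj_rest x⟩)
  invFun z := A.incl z.1 + z.2
  map_add' x y := by ext <;> simp
  map_smul' c x := by ext <;> simp
  left_inv x := A.incl_proj_add_rest x
  right_inv z := by
    have h : A.proj z.2 = 0 := z.2.2
    ext
    · simp [A.proj_incl, h]
    · simp [A.rest_incl, A.rest_of_proj_eq_zero h]

theorem norm_sq_decompose (x : X) :
    ‖x‖ ^ 2 = ‖(A.decompose x).1‖ ^ 2 + ‖(A.decompose x).2‖ ^ 2 := A.norm_sq_eq x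

/-- Hilbert extensions with isometric Hilbert summands are isometric. -/
noncomputable def congr {Y : Type w} [NormedAddCommGroup Y] [NormedSpace 𝕜 Y]
    (B : HilbertExtension 𝕜 F Y) (f : A.hilbert ≃ₗᵢ[𝕜] B.hilbert) : X ≃ₗᵢ[𝕜] Y where
  toLinearEquiv := A.decompose.trans
    (((LinearEquiv.refl 𝕜 F).prodCongr f.toLinearEquiv).trans B.decompose.symm)
  norm_map' x := by
    refine (sq_eq_sq₀ (norm_nonneg _) (norm_nonneg _)).1 ?_
    rw [B.norm_sq_decompose, A.norm_sq_decompose x]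
    simp

/-- The modular direct sum of a space and a Hilbert space. -/
def ofProd (𝕜 : Type uK) [RCLike 𝕜] (F : Type u) [NormedAddCommGroup F] [NormedSpace 𝕜 F]
    (H : Type v) [NormedAddCommGroup H] [InnerProductSpace 𝕜 H] :
    HilbertExtension 𝕜 F (WithLp 2 (F × H)) where
  incl :=
    { toFun := fun e => WithLp.toLp 2 (e, 0)
      map_add' := fun x y => by rw [← WithLp.toLp_add]; simp
      map_smul' := fun c x => by rw [RingHom.id_apply, ← WithLp.toLp_smul]; simp
      norm_map' := fun x => by
        change ‖WithLp.toLp 2 (x, (0 : H))‖ = ‖x‖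
        simp }
  proj :=
    { toFun := fun z => z.fst
      map_add' := fun _ _ => rfl
      map_smul' := fun _ _ => rfl }
  proj_incl _ := rfl
  norm_sq x := by
    change ‖x‖ ^ 2 = ‖x.fst‖ ^ 2 + ‖x - WithLp.toLp 2 (x.fst, 0)‖ ^ 2
    rw [WithLp.prod_norm_sq_eq_of_L2, WithLp.prod_norm_sq_eq_of_L2 (x - _)]
    simp
  parallelogram x y hx hy := by
    replace hx : x.fst = 0 := hx
    replace hy : y.fst = 0 := hy
    simp only [WithLp.prod_norm_sq_eq_of_L2, WithLp.add_fst, WithLp.sub_fst, WithLp.add_snd,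
      WithLp.sub_snd, hx, hy]
    have := parallelogram_law_with_norm 𝕜 x.snd y.snd
    simpa [← sq] using this

end Decomposition

end HilbertExtension

/-! ### The modular `‖x‖²` and its Luxemburg norm. -/

section Modular

variable {𝕜 : Type uK} [RCLike 𝕜] {X : Type u} [NormedAddCommGroup X] [NormedSpace 𝕜 X]

theorem sInf_setOf_pos_le {a : ℝ} (ha : 0 ≤ a) : sInf {r : ℝ | 0 < r ∧ a ≤ r} = a := by
  rcases ha.eq_or_lt with rfl | ha
  · have : {r : ℝ | 0 < r ∧ 0 ≤ r} = Set.Ioi 0 := by ext r; simpa using le_of_lt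
    rw [this, csInf_Ioi]
  · have : {r : ℝ | 0 < r ∧ a ≤ r} = Set.Ici a := by
      ext r; simpa using fun h : a ≤ r => ha.trans_le h
    rw [this, csInf_Ici]

theorem luxemburgNorm_eq_of_sq {X : Type u} [AddCommGroup X] [Module 𝕜 X] {Θ : X → ℝ} {x : X}
    {a : ℝ} (ha : 0 ≤ a) (h : ∀ r : ℝ, Θ ((r : 𝕜) • x) = r ^ 2 * a ^ 2) :
    luxemburgNorm 𝕜 Θ x = a := by
  rw [luxemburgNorm, ← sInf_setOf_pos_le ha]
  congr 1
  ext r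
  refine and_congr_right fun hr => ?_
  rw [h, ← mul_pow, sq_le_one_iff₀ (by positivity), inv_mul_le_one₀ hr]

theorem isDeltaTwoModularBanach_norm_sq [CompleteSpace X] :
    IsDeltaTwoModularBanach 𝕜 X (fun x => ‖x‖ ^ 2) where
  complete := inferInstance
  modular :=
    { nonneg := fun x => by positivity
      map_zero := by simp
      faithful := fun x hx => by simpa using hx
      symmetric := fun c x hc => by simp [norm_smul, hc]
      convex := fun x y s t hs ht hst => by
        have h := norm_add_le ((s : 𝕜) • x) ((t : 𝕜) • y)
        rw [norm_smul, norm_smul, RCLike.norm_ofReal, RCLike.norm_ofReal, abs_of_nonneg hs,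
          abs_of_nonneg ht] at h
        refine (pow_le_pow_left₀ (norm_nonneg _) h 2).trans ?_
        obtain rfl : t = 1 - s := by linarith
        -- The defect of convexity of the square is `s * t * (‖x‖ - ‖y‖) ^ 2`.
        nlinarith [mul_nonneg (mul_nonneg hs ht) (sq_nonneg (‖x‖ - ‖y‖))] }
  norm_eq x := (luxemburgNorm_eq_of_sq (norm_nonneg x) fun r => by
    rw [norm_smul, RCLike.norm_ofReal, mul_pow, sq_abs]).symm
  delta_two := ⟨4, fun x => le_of_eq (by rw [norm_smul, RCLike.norm_two]; ring)⟩

theorem luxemburgNorm_sumHilbertModular {H : Type v} [NormedAddCommGroup H] [NormedSpace 𝕜 H]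
    (z : X × H) :
    luxemburgNorm 𝕜 (sumHilbertModular fun x : X => ‖x‖ ^ 2) z = ‖WithLp.toLp 2 z‖ := by
  refine luxemburgNorm_eq_of_sq (norm_nonneg _) fun r => ?_
  rw [WithLp.prod_norm_sq_eq_of_L2]
  simp only [sumHilbertModular, Prod.smul_fst, Prod.smul_snd, norm_smul, RCLike.norm_ofReal,
    mul_pow, sq_abs, WithLp.toLp_fst, WithLp.toLp_snd]
  ring

end Modular

/-! ### Ultrapowers and embeddings of `ℓ₂(E)`. -/

section Conclusions

variable {𝕜 : Type uK} [RCLike 𝕜]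
  {E : ℕ → Type u} [∀ n, NormedAddCommGroup (E n)] [∀ n, NormedSpace 𝕜 (E n)]
  [∀ n, FiniteDimensional 𝕜 (E n)] {p : ℕ → ℝ}

theorem ultrapowersIsomodular_lp (hp : ∀ n, 2 < p n) (hlim : Tendsto p atTop (𝓝 2))
    (ha : ∀ (n : ℕ) (x y : E n),
      2 * (‖x‖ ^ p n + ‖y‖ ^ p n) ^ (2 / p n) ≤ ‖x + y‖ ^ 2 + ‖x - y‖ ^ 2) :
    UltrapowersIsomodular.{uK, u, v} 𝕜 (lp E 2) (fun x => ‖x‖ ^ 2) := by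
  intro I 𝒰
  have : ∀ n, CompleteSpace (E n) := fun n => FiniteDimensional.complete 𝕜 (E n)
  let A := (HilbertExtension.refl 𝕜 (lp E 2)).ultrapower 𝒰 (asymptotic_parallelogram hp hlim ha)
  refine ⟨A.hilbert, inferInstance, A.innerProductSpace, A.completeSpace_hilbert, A.decompose,
    fun x => ?_⟩
  rw [sumHilbertModular, ← A.norm_sq_decompose]
  exact (tendsto_norm_ultraMk x).pow 2

theorem embeddingsOnto_lp (hp : ∀ n, 2 < p n) (hlim : Tendsto p atTop (𝓝 2))
    (ha : ∀ (n : ℕ) (x y : E n),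
      2 * (‖x‖ ^ p n + ‖y‖ ^ p n) ^ (2 / p n) ≤ ‖x + y‖ ^ 2 + ‖x - y‖ ^ 2)
    (hb : ∀ n : ℕ, ∃ (d : ℕ) (b : Module.Basis (Fin d) 𝕜 (E n)),
      ∀ j, ∃ i, IsEllPair 𝕜 (p n) (b i) (b j)) :
    EmbeddingsOnto.{uK, u, w} 𝕜 (lp E 2) (fun x => ‖x‖ ^ 2) := by
  intro H _ _ _ T hT
  let S : lp E 2 →ₗᵢ[𝕜] WithLp 2 (lp E 2 × H) :=
    { toLinearMap := (WithLp.linearEquiv 2 𝕜 (lp E 2 × H)).symm.toLinearMap ∘ₗ T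
      norm_map' := fun x => by
        rw [← hT, luxemburgNorm_sumHilbertModular]
        rfl }
  have h := (HilbertExtension.ofProd 𝕜 (lp E 2) H).range_eq_range_incl hp ha hb hlim S
  have h1 := congrArg (Submodule.map (WithLp.linearEquiv 2 𝕜 (lp E 2 × H)).toLinearMap) h
  rw [← LinearMap.range_comp, ← LinearMap.range_comp] at h1
  exact h1

end Conclusions

/-! ### Density characters. -/

section Density

theorem exists_dense_mk_eq_densityCharacter (X : Type u) [TopologicalSpace X] :
    ∃ s : Set X, Dense s ∧ #s = densityCharacter X :=
  csInf_mem (s := {c | ∃ s : Set X, Dense s ∧ #s = c}) ⟨_, Set.univ, dense_univ, rfl⟩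

theorem densityCharacter_le {X : Type u} [TopologicalSpace X] {s : Set X} (hs : Dense s) :
    densityCharacter X ≤ #s :=
  csInf_le' ⟨s, hs, rfl⟩

/-- The balls of radius `1 / 2` around the points are disjoint, and a dense set meets each. -/
theorem mk_le_densityCharacter {X ι : Type u} [NormedAddCommGroup X] (f : ι → X)
    (hf : Pairwise fun i j => 1 ≤ ‖f i - f j‖) : #ι ≤ densityCharacter X := by
  obtain ⟨s, hs, hcard⟩ := exists_dense_mk_eq_densityCharacter X
  rw [← hcard]
  choose g hg hgs using fun i => hs.exists_dist_lt (f i) (show (0 : ℝ) < 1 / 2 by norm_num)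
  refine Cardinal.mk_le_of_injective (f := fun i => (⟨g i, hg i⟩ : s)) fun i j hij => ?_
  by_contra hne
  have h1 : g i = g j := congrArg Subtype.val hij
  have h2 := dist_triangle_right (f i) (f j) (g i)
  have h3 := hgs j
  rw [← h1] at h3
  have h4 : 1 ≤ ‖f i - f j‖ := hf hne
  rw [← dist_eq_norm] at h4
  linarith [hgs i]

theorem densityCharacter_le_of_dense_span (𝕜 : Type uK) [RCLike 𝕜] {X : Type u}
    [NormedAddCommGroup X] [NormedSpace 𝕜 X] {S : Set X}
    (hS : (Submodule.span 𝕜 S).topologicalClosure = ⊤) : densityCharacter X ≤ max ℵ₀ #S := by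
  -- Finite combinations with coefficients from a countable dense subset of `𝕜`.
  let f : List (S × ℕ) → X := fun l =>
    (l.map fun a => TopologicalSpace.denseSeq 𝕜 a.2 • (a.1 : X)).sum
  have hadd : ∀ x ∈ closure (Set.range f), ∀ y ∈ closure (Set.range f),
      x + y ∈ closure (Set.range f) := fun x hx y hy =>
    map_mem_closure₂ continuous_add hx hy (by
      rintro _ ⟨l, rfl⟩ _ ⟨m, rfl⟩
      exact ⟨l ++ m, by simp [f]⟩)
  have hspan : (Submodule.span 𝕜 S : Set X) ⊆ closure (Set.range f) := fun x hx => by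
    induction hx using Submodule.closure_induction with
    | zero => exact subset_closure ⟨[], rfl⟩
    | add x y _ _ hx hy => exact hadd x hx y hy
    | smul_mem c x hx =>
      refine map_mem_closure (f := fun c : 𝕜 => c • x) (by fun_prop)
        (TopologicalSpace.denseRange_denseSeq 𝕜 c) ?_
      rintro _ ⟨k, rfl⟩
      exact ⟨[(⟨x, hx⟩, k)], by simp [f]⟩
  have hdense : Dense (Set.range f) := fun x => by
    have hx : x ∈ (Submodule.span 𝕜 S).topologicalClosure := hS ▸ Submodule.mem_top
    exact closure_minimal hspan isClosed_closure hx
  calc densityCharacter X ≤ #(Set.range f) := densityCharacter_le hdense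
    _ ≤ #(List (S × ℕ)) := Cardinal.mk_range_le
    _ ≤ max ℵ₀ #(S × ℕ) := Cardinal.mk_list_le_max _
    _ ≤ max ℵ₀ #S := by
      refine max_le (le_max_left _ _) ?_
      rw [Cardinal.mk_prod, Cardinal.lift_id', Cardinal.mk_nat, Cardinal.lift_aleph0]
      refine (Cardinal.mul_le_max _ _).trans (le_of_eq ?_)
      rw [max_comm #S ℵ₀, max_eq_left (le_max_left _ _)]

end Density

theorem exists_countable_dense_span (𝕜 : Type uK) [RCLike 𝕜] (E : ℕ → Type u)
    [∀ n, NormedAddCommGroup (E n)] [∀ n, NormedSpace 𝕜 (E n)] [∀ n, FiniteDimensional 𝕜 (E n)] :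
    ∃ S : Set (lp E 2), S.Countable ∧ (Submodule.span 𝕜 S).topologicalClosure = ⊤ := by
  let f : (Σ n, Fin (Module.finrank 𝕜 (E n))) → lp E 2 := fun z =>
    lp.single 2 z.1 (Module.finBasis 𝕜 (E z.1) z.2)
  refine ⟨Set.range f, Set.countable_range f, eq_top_iff.2 fun x _ => ?_⟩
  refine mem_closure_of_tendsto (lp.tendsto_truncate x) (Eventually.of_forall fun F => ?_)
  refine Submodule.sum_mem _ fun n _ => ?_
  let s : E n →ₗ[𝕜] lp E 2 :=
    { toFun := lp.single 2 n
      map_add' := lp.single_add 2 n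
      map_smul' := lp.single_smul 2 n }
  have hs : ⊤ ≤ (Submodule.span 𝕜 (Set.range f)).comap s := by
    rw [← (Module.finBasis 𝕜 (E n)).span_eq, Submodule.span_le]
    rintro _ ⟨j, rfl⟩
    exact Submodule.subset_span ⟨⟨n, j⟩, rfl⟩
  exact hs (Submodule.mem_top (x := x n))

/-! ### Hilbert dimension and classification of extensions. -/

section HilbertBasis

variable {𝕜 : Type uK} [RCLike 𝕜]

/-- Hilbert spaces with equipotent Hilbert bases are isometric. -/
theorem HilbertBasis.nonempty_linearIsometryEquiv {H : Type u} [NormedAddCommGroup H]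
    [InnerProductSpace 𝕜 H] [CompleteSpace H] {K : Type v} [NormedAddCommGroup K]
    [InnerProductSpace 𝕜 K] {ι ι' : Type*} (b : HilbertBasis ι 𝕜 H) (c : HilbertBasis ι' 𝕜 K)
    (e : ι' ≃ ι) : Nonempty (H ≃ₗᵢ[𝕜] K) := by
  let b' : HilbertBasis ι' 𝕜 H := HilbertBasis.mk (b.orthonormal.comp e e.injective) (by
    rw [e.surjective.range_comp (g := b), b.dense_span])
  exact ⟨b'.repr.trans c.repr.symm⟩

theorem Orthonormal.one_le_norm_sub {H : Type u} [NormedAddCommGroup H] [InnerProductSpace 𝕜 H]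
    {ι : Type*} {f : ι → H} (hf : Orthonormal 𝕜 f) : Pairwise fun i j => 1 ≤ ‖f i - f j‖ := by
  intro i j hij
  have h := norm_sub_sq (𝕜 := 𝕜) (f i) (f j)
  rw [hf.2 hij, hf.1 i, hf.1 j, map_zero] at h
  nlinarith [norm_nonneg (f i - f j)]

end HilbertBasis

namespace HilbertExtension

variable {𝕜 : Type uK} [RCLike 𝕜]
  {F : Type u} [NormedAddCommGroup F] [NormedSpace 𝕜 F]

/-- The Hilbert dimension of the second summand, if the extension has uncountable density. -/
theorem exists_hilbertBasis_mk_eq {X : Type u} [NormedAddCommGroup X] [NormedSpace 𝕜 X]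
    [CompleteSpace X] (A : HilbertExtension 𝕜 F X)
    (hF : ∃ S : Set F, S.Countable ∧ (Submodule.span 𝕜 S).topologicalClosure = ⊤)
    (hX : ℵ₀ < densityCharacter X) : letI := A.innerProductSpace
    ∃ (ι : Type u) (_ : HilbertBasis ι 𝕜 A.hilbert), #ι = densityCharacter X := by
  let := A.innerProductSpace
  have := A.completeSpace_hilbert
  obtain ⟨w, b, hb⟩ := exists_hilbertBasis 𝕜 A.hilbert
  refine ⟨w, b, le_antisymm ?_ ?_⟩
  · exact mk_le_densityCharacter (fun i => (b i : X)) b.orthonormal.one_le_norm_sub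
  · obtain ⟨S, hS, hSF⟩ := hF
    let S' : Set X := A.incl '' S ∪ Set.range fun i => (b i : X)
    have h : (Submodule.span 𝕜 S').topologicalClosure = ⊤ := by
      refine eq_top_iff.2 fun x _ => ?_
      rw [← A.incl_proj_add_rest x]
      refine add_mem ?_ ?_
      · have h1 : A.proj x ∈ (Submodule.span 𝕜 S).topologicalClosure := hSF ▸ Submodule.mem_top
        refine map_mem_closure A.incl.continuous h1 ?_
        change Submodule.span 𝕜 S ≤ (Submodule.span 𝕜 S').comap A.incl.toLinearMap
        exact Submodule.span_le.2 fun y hy =>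
          Submodule.subset_span (Or.inl (Set.mem_image_of_mem _ hy))
      · have h1 : (⟨A.rest x, A.proj_rest x⟩ : A.hilbert) ∈
            (Submodule.span 𝕜 (Set.range b)).topologicalClosure := b.dense_span ▸ Submodule.mem_top
        refine map_mem_closure (f := ((↑) : A.hilbert → X)) continuous_subtype_val h1 ?_
        change Submodule.span 𝕜 (Set.range b) ≤ (Submodule.span 𝕜 S').comap A.hilbert.subtype
        refine Submodule.span_le.2 ?_
        rintro _ ⟨i, rfl⟩
        exact Submodule.subset_span (Or.inr ⟨i, rfl⟩)
    have h1 := densityCharacter_le_of_dense_span 𝕜 h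
    have h2 : #S' ≤ max ℵ₀ #w := by
      refine (Cardinal.mk_union_le _ _).trans ((Cardinal.add_le_max _ _).trans ?_)
      have h3 : #(A.incl '' S) ≤ ℵ₀ := Cardinal.mk_le_aleph0_iff.2 (hS.image _).to_subtype
      have h4 : #(Set.range fun i => (b i : X)) ≤ #w := Cardinal.mk_range_le
      exact max_le (max_le (h3.trans (le_max_left _ _)) (h4.trans (le_max_right _ _)))
        (le_max_left _ _)
    have h3 : densityCharacter X ≤ max ℵ₀ #w := h1.trans (max_le (le_max_left _ _) h2)
    -- Uncountable density rules out `ℵ₀`, so the separable summand does not affect the count.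
    exact (le_max_iff.1 h3).resolve_left hX.not_ge

/-- Hilbert extensions of a separable space of the same uncountable density are isometric. -/
theorem nonempty_linearIsometryEquiv {X Y : Type u} [NormedAddCommGroup X] [NormedSpace 𝕜 X]
    [CompleteSpace X] [NormedAddCommGroup Y] [NormedSpace 𝕜 Y] [CompleteSpace Y]
    (A : HilbertExtension 𝕜 F X) (B : HilbertExtension 𝕜 F Y)
    (hF : ∃ S : Set F, S.Countable ∧ (Submodule.span 𝕜 S).topologicalClosure = ⊤)
    (hX : ℵ₀ < densityCharacter X) (hXY : densityCharacter X = densityCharacter Y) :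
    Nonempty (X ≃ₗᵢ[𝕜] Y) := by
  let := A.innerProductSpace
  let := B.innerProductSpace
  have := A.completeSpace_hilbert
  obtain ⟨ι, b, hι⟩ := A.exists_hilbertBasis_mk_eq hF hX
  obtain ⟨ι', c, hι'⟩ := B.exists_hilbertBasis_mk_eq hF (hXY ▸ hX)
  obtain ⟨e⟩ := Cardinal.eq.1 (hι'.trans (hXY.symm.trans hι.symm))
  obtain ⟨f⟩ := b.nonempty_linearIsometryEquiv c e
  exact ⟨A.congr B f⟩

end HilbertExtension

/-! ### Nonseparable ultrapowers and categoricity. -/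

section UltrapowerExamples

variable {𝕜 : Type uK} [RCLike 𝕜] {X : Type u} [NormedAddCommGroup X] [NormedSpace 𝕜 X]

/-- Diagonalization: given countably many classes, Riesz's lemma picks bounded `y i` at distance at
least `1` from the `i`-th terms of the first `i + 1` representatives. The class of `y` is then at
distance at least `1` from all of them. -/
theorem aleph0_lt_densityCharacter_ultrapower (hX : ¬ FiniteDimensional 𝕜 X)
    {𝒰 : Ultrafilter (ULift.{u} ℕ)} (h𝒰 : ∀ k : ℕ, ∀ᶠ i in (𝒰 : Filter (ULift.{u} ℕ)), k ≤ i.down) :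
    ℵ₀ < densityCharacter (Ultrapower 𝕜 𝒰 X) := by
  obtain ⟨s, hs, hcard⟩ := exists_dense_mk_eq_densityCharacter (Ultrapower 𝕜 𝒰 X)
  rw [← hcard, ← not_le, Cardinal.mk_le_aleph0_iff]
  intro hcount
  obtain ⟨z, hz⟩ := (Set.to_countable s).exists_eq_range hs.nonempty
  choose x hx using fun k => ultraMk_surjective (z k)
  obtain ⟨c, hc⟩ := NormedField.exists_one_lt_norm 𝕜
  classical
  choose y hy hyx using fun i : ULift.{u} ℕ =>
    exists_norm_le_le_norm_sub_of_finset hc (lt_add_one ‖c‖) hX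
      ((Finset.range (i.down + 1)).image fun k => x k i)
  obtain ⟨w, hw, hdist⟩ := hs.exists_dist_lt (ultraMk 𝕜 𝒰 (lp.ofBound y hy)) one_pos
  rw [hz] at hw
  obtain ⟨k, rfl⟩ := hw
  rw [dist_comm, dist_eq_norm, ← hx, ← map_sub] at hdist
  refine hdist.not_ge (ge_of_tendsto (tendsto_norm_ultraMk _) ?_)
  filter_upwards [h𝒰 k] with i hi
  exact hyx i _ (Finset.mem_image_of_mem _ (Finset.mem_range.2 (Nat.lt_succ_of_le hi)))

variable (𝕜 X) in
/-- A space is its own principal ultrapower. -/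
theorem nonempty_equiv_ultrapower_pure {I : Type v} (i : I) :
    Nonempty (X ≃ₗᵢ[𝕜] Ultrapower 𝕜 (pure i : Ultrafilter I) X) := by
  refine ⟨LinearIsometryEquiv.ofSurjective (ultraDiag 𝕜 _ X) fun z => ?_⟩
  obtain ⟨x, rfl⟩ := ultraMk_surjective z
  refine ⟨x i, (Submodule.Quotient.eq _).2 (mem_nullFamilies.2 ?_)⟩
  rw [Ultrafilter.coe_pure, tendsto_pure_left]
  intro s hs
  simpa using mem_of_mem_nhds hs

theorem elementarilyEquivalent_ultrapower {I : Type u} (𝒰 : Ultrafilter I) :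
    ElementarilyEquivalent 𝕜 X (Ultrapower 𝕜 𝒰 X) :=
  ⟨I, PUnit, 𝒰, pure PUnit.unit, nonempty_equiv_ultrapower_pure 𝕜 _ _⟩

end UltrapowerExamples

theorem not_finiteDimensional_lp {𝕜 : Type uK} [RCLike 𝕜] {E : ℕ → Type u}
    [∀ n, NormedAddCommGroup (E n)] [∀ n, NormedSpace 𝕜 (E n)]
    (hE : {n | Nontrivial (E n)}.Infinite) : ¬ FiniteDimensional 𝕜 (lp E 2) := by
  intro hfin
  have h0 : ∀ n : {n | Nontrivial (E n)}, ∃ y : E n, y ≠ 0 := fun n =>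
    have : Nontrivial (E n) := n.2
    exists_ne 0
  choose y hy using h0
  have hli : LinearIndependent 𝕜 fun n : {n | Nontrivial (E n)} => lp.single 2 (n : ℕ) (y n) := by
    rw [linearIndependent_iff']
    intro s g hg i hi
    have h := congrArg (fun x : lp E 2 => x (i : ℕ)) hg
    simp only [lp.coeFn_sum, Finset.sum_apply, lp.coeFn_smul, Pi.smul_apply] at h
    rw [Finset.sum_eq_single_of_mem i hi, lp.single_apply_self] at h
    · exact (smul_eq_zero.1 h).resolve_right (hy i)
    · intro j _ hji
      rw [lp.single_apply_ne _ _ _ fun hh => hji (Subtype.ext hh.symm), smul_zero]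
  have := hE.to_subtype
  exact not_finite_iff_infinite.2 this hli.finite

theorem isUncountablyCategorical_lp {𝕜 : Type uK} [RCLike 𝕜] {E : ℕ → Type u}
    [∀ n, NormedAddCommGroup (E n)] [∀ n, NormedSpace 𝕜 (E n)] [∀ n, FiniteDimensional 𝕜 (E n)]
    (hE : {n | Nontrivial (E n)}.Infinite)
    {p : ℕ → ℝ} (hp : ∀ n, 2 < p n) (hlim : Tendsto p atTop (𝓝 2))
    (ha : ∀ (n : ℕ) (x y : E n),
      2 * (‖x‖ ^ p n + ‖y‖ ^ p n) ^ (2 / p n) ≤ ‖x + y‖ ^ 2 + ‖x - y‖ ^ 2)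
    (hb : ∀ n : ℕ, ∃ (d : ℕ) (b : Module.Basis (Fin d) 𝕜 (E n)),
      ∀ j, ∃ i, IsEllPair 𝕜 (p n) (b i) (b j)) :
    IsUncountablyCategorical 𝕜 (lp E 2) := by
  have : ∀ n, CompleteSpace (E n) := fun n => FiniteDimensional.complete 𝕜 (E n)
  have hinf := not_finiteDimensional_lp (𝕜 := 𝕜) hE
  -- A nonprincipal ultrafilter on `ℕ`, lifted because elementary equivalence takes index sets in
  -- the universe of the space.
  let 𝒰 : Ultrafilter (ULift.{u} ℕ) := (hyperfilter ℕ).map ULift.up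
  have h𝒰 : ∀ k : ℕ, ∀ᶠ i in (𝒰 : Filter (ULift.{u} ℕ)), k ≤ i.down := fun k =>
    Nat.hyperfilter_le_atTop (eventually_ge_atTop k)
  have hκ := aleph0_lt_densityCharacter_ultrapower hinf h𝒰
  -- The exact value of this cardinal is irrelevant: uniqueness only needs it to be uncountable, and
  -- the ultrapower itself gives existence.
  refine ⟨densityCharacter (Ultrapower 𝕜 𝒰 (lp E 2)), hκ, hinf,
    ⟨_, inferInstance, inferInstance, inferInstance, elementarilyEquivalent_ultrapower 𝒰, rfl⟩, ?_⟩
  intro Y _ _ _ Z _ _ _ hY hYκ hZ hZκ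
  obtain ⟨A⟩ := HilbertExtension.nonempty_of_elementarilyEquivalent hp hlim ha hb hY
  obtain ⟨B⟩ := HilbertExtension.nonempty_of_elementarilyEquivalent hp hlim ha hb hZ
  exact A.nonempty_linearIsometryEquiv B (exists_countable_dense_span 𝕜 E) (hYκ ▸ hκ)
    (hYκ.trans hZκ.symm)

theorem proposition5p2 {𝕜 : Type uK} [RCLike 𝕜] (E : ℕ → Type u)
    [∀ n, NormedAddCommGroup (E n)] [∀ n, NormedSpace 𝕜 (E n)] [∀ n, FiniteDimensional 𝕜 (E n)]
    (hE : {n | Nontrivial (E n)}.Infinite)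
    (p : ℕ → ℝ) (hp : ∀ n, 2 < p n) (hlim : Tendsto p atTop (𝓝 2))
    (ha : ∀ (n : ℕ) (x y : E n),
      2 * (‖x‖ ^ p n + ‖y‖ ^ p n) ^ (2 / p n) ≤ ‖x + y‖ ^ 2 + ‖x - y‖ ^ 2)
    (hb : ∀ n : ℕ, ∃ (d : ℕ) (b : Module.Basis (Fin d) 𝕜 (E n)),
      ∀ j, ∃ i, IsEllPair 𝕜 (p n) (b i) (b j)) :
    ¬ FiniteDimensional 𝕜 (lp E 2) ∧
    IsDeltaTwoModularBanach 𝕜 (lp E 2) (fun x => ‖x‖ ^ 2) ∧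
    UltrapowersIsomodular.{uK, u, v} 𝕜 (lp E 2) (fun x => ‖x‖ ^ 2) ∧
    EmbeddingsOnto.{uK, u, w} 𝕜 (lp E 2) (fun x => ‖x‖ ^ 2) ∧
    IsUncountablyCategorical 𝕜 (lp E 2) := by
  have : ∀ n, CompleteSpace (E n) := fun n => FiniteDimensional.complete 𝕜 (E n)
  exact ⟨not_finiteDimensional_lp hE, isDeltaTwoModularBanach_norm_sq,
    ultrapowersIsomodular_lp hp hlim ha, embeddingsOnto_lp hp hlim ha hb,
    isUncountablyCategorical_lp hE hp hlim ha hb⟩
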